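/- Let $d\ge 1$, $\mathcal X=\mathbb R^d_{\ge 0}$, and let $\mathcal C=\{h_v : v\in\mathbb R^d_{\ge0}\}$ be the axis-aligned rectangles containing the origin, where $h_v(x)=+1$ if $x_i\le v_i$ for all $i$ and $h_v(x)=-1$ otherwise. For $S\subseteq\mathcal X\times\{\pm1\}$ let $\mathcal V(S)=\{h\in\mathcal C: h(x)=y\ \forall (x,y)\in S\}$, let $\mathbb V$ be the set of all such version spaces, and for $V\subseteq\mathcal C$ let $V_{x\to \ell}=\{h\in V: h(x)=\ell\}$. A set $U$ of labeled examples is realizable in $V$ if some $h\in V$ agrees with all of $U$. A function $f$, assigning to each $k$-element $U\subseteq\mathcal X\times\{\pm1\}$ and each $V\in\mathbb V$ a number $f(U;V)\in[0,c]$, is called $(m,c,k)$-good if 1. (monotonicity) $f(U;V)\ge f(U;V_{x\to y})$ whenever $|U|=k$, $V\in\mathbb V$ and $U\cup\{(x,y)\}$ is realizable in $V$; 2. ($m$-robustness) for every $h\in\mathcal C$ and every $M\subseteq\mathcal X\times\{\pm1\}$ with $|M|=m$ labeled by $h$ there are $U\subseteq M$ with $|U|=k$ and $(x,y)\in M\setminus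 U$ such that for every $A\supseteq M\setminus(U\cup\{(x,y)\})$ labeled by $h$, with $V=\mathcal V(A)$, either $f(U;V)-f(U;V_{x\to -y})\ge1$ or $U$ is not realizable in $V_{x\to -y}$. For a singleton $U=\{(x,y)\}$ let $f_{\mathrm{rect}}(U;V)$ be the number of $i\in\{1,\dots,d\}$ such that some $h\in V_{x\to y}$ has $h(\delta_i(x))=-1$, where $\delta_i(x)$ agrees with $x$ in coordinate $i$ and is $0$ in the others. *Adversarial injection model.* A probability distribution $\mathcal D$ on $\mathcal X$ and a target $c^\star\in\mathcal C$ are fixed. In each round $t=1,\dots,T$ a (possibly randomized) adversary chooses, depending on the past rounds, a bit $q_t$; if $q_t=0$ then $x_t\sim\mathcal D$ is drawn independently of the past, and if $q_t=1$ the adversary chooses $x_t\in\mathcal X$, depending on the past rounds. The learner, who does not see $q_t$, sees $x_t$, outputs $\hat y_t\in\{\pm1,\perp\}$ and then sees $y_t=c^\star(x_t)$. The combined error is $\mathrm{err}_T=|\{t:\hat y_t\ne\perp,\ \hat y_t\neq y_t\}|+|\{t:\hat y_t=\perp,\ q_t=0\}|$. *Potential learner* (score $f$ on $k$-element sets, threshold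 $\alpha>0$). Let $S=\{(x_s,y_s):s<t\}$ and $\rho_f(S)=\sum_{U\subseteq S,|U|=k}f(U;\mathcal V(S\setminus U))$. If $\mathcal V(S)_{x_t\to+1}=\emptyset$, output $-1$; otherwise, if $\mathcal V(S)_{x_t\to-1}=\emptyset$, output $+1$; otherwise let $\Delta_b=\rho_f(S)-\rho_f(S\cup\{(x_t,b)\})$ for $b\in\{\pm1\}$, output $-b^\star$ with $b^\star\in\arg\max_b\Delta_b$ if $\max_b\Delta_b\ge\alpha$ (ties being resolved by a fixed label), and output $\perp$ otherwise. **Lemma.** For every $d\ge1$, $f_{\mathrm{rect}}$ is $(2d+1,d,1)$-good. Moreover, with a suitable threshold $\alpha=\alpha(d,T)>0$, the potential learner with $f_{\mathrm{rect}}$ achieves expected combined error $\tilde{O}(d\sqrt T)$: there are universal constants $K>0$ and $p\in\mathbb N$ such that for all $d,T\ge1$ there is an $\alpha>0$ such that, for all $\mathcal D$, all $c^\star\in\mathcal C$ and all adversaries, $$\mathbb E[\mathrm{err}_T]\le K\,d\,\sqrt T\,(1+\log T)^p .$$ -/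

import Mathlib

open MeasureTheory
open scoped NNReal

/-! ## Concept classes, version spaces and scores

Labels are the units `1` and `-1` of `ℤ`; a concept on `X` is a function `X → ℤˣ`, a labeled example
is an element of `X × ℤˣ`. -/

/-- The version space `𝒱(S)`: the concepts of `C` that agree with all labeled examples of `S`. -/
def versionSpace {X : Type*} (C : Set (X → ℤˣ)) (S : Set (X × ℤˣ)) : Set (X → ℤˣ) :=
  {h | h ∈ C ∧ ∀ z ∈ S, h z.1 = z.2}

/-- The set `𝕍` of all version spaces of `C`. -/
def versionSpaces {X : Type*} (C : Set (X → ℤˣ)) : Set (Set (X → ℤˣ)) :=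
  Set.range (versionSpace C)

/-- The restriction `V_{x → l}`. -/
def restrictTo {X : Type*} (V : Set (X → ℤˣ)) (x : X) (l : ℤˣ) : Set (X → ℤˣ) :=
  {h | h ∈ V ∧ h x = l}

/-- The labeled examples of `U` are simultaneously realized by some concept of `V`. -/
def RealizableIn {X : Type*} (U : Set (X × ℤˣ)) (V : Set (X → ℤˣ)) : Prop :=
  ∃ h ∈ V, ∀ z ∈ U, h z.1 = z.2

/-- The function `f : 𝒫_k(X × {±1}) × 𝕍 → [0, c]` is `(m, c, k)`-good for the class `C`:
window size `m`, bound `c`, subset size `k`. Only the values of `f` on sets `U` with `k` elements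
and on version spaces of `C` matter. -/
structure IsGood {X : Type*} (C : Set (X → ℤˣ))
    (f : Finset (X × ℤˣ) → Set (X → ℤˣ) → ℝ) (m : ℕ) (c : ℝ) (k : ℕ) : Prop where
  /-- `f` takes values in `[0, c]`. -/
  bounded : ∀ U : Finset (X × ℤˣ), U.card = k → ∀ V ∈ versionSpaces C, f U V ∈ Set.Icc 0 c
  /-- Monotonicity: if `(x, y)` is realizable together with `U` in `V` (so in particular `V` is
  consistent with `U`), then restricting `V` by `x → y` does not increase the score. -/
  monotone : ∀ U : Finset (X × ℤˣ), U.card = k → ∀ V ∈ versionSpaces C, ∀ (x : X) (y : ℤˣ),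
    RealizableIn (insert (x, y) (U : Set (X × ℤˣ))) V → f U (restrictTo V x y) ≤ f U V
  /-- `m`-robustness. -/
  robust : ∀ h ∈ C, ∀ M : Finset (X × ℤˣ), M.card = m → (∀ z ∈ M, h z.1 = z.2) →
    ∃ U : Finset (X × ℤˣ), U ⊆ M ∧ U.card = k ∧ ∃ w ∈ M, w ∉ U ∧
      ∀ A : Set (X × ℤˣ), (∀ z ∈ A, h z.1 = z.2) →
        (M : Set (X × ℤˣ)) \ ((U : Set (X × ℤˣ)) ∪ {w}) ⊆ A →
        1 ≤ f U (versionSpace C A) - f U (restrictTo (versionSpace C A) w.1 (-w.2)) ∨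
          ¬ RealizableIn (U : Set (X × ℤˣ)) (restrictTo (versionSpace C A) w.1 (-w.2))

/-! ## The potential learner -/

/-- The leave-`k`-out potential `ρ_f(S) = ∑_{U ⊆ S, |U| = k} f(U; 𝒱(S \ U))`. -/
noncomputable def potential {X : Type*} (C : Set (X → ℤˣ)) (k : ℕ)
    (f : Finset (X × ℤˣ) → Set (X → ℤˣ) → ℝ) (S : Finset (X × ℤˣ)) : ℝ :=
  ∑ U ∈ S.powersetCard k, f U (versionSpace C ((S : Set (X × ℤˣ)) \ (U : Set (X × ℤˣ))))

open Classical in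
/-- The potential drop `Δ_b = ρ_f(S) - ρ_f(S ∪ {(x, b)})`. -/
noncomputable def potentialDrop {X : Type*} (C : Set (X → ℤˣ)) (k : ℕ)
    (f : Finset (X × ℤˣ) → Set (X → ℤˣ) → ℝ) (S : Finset (X × ℤˣ)) (x : X) (b : ℤˣ) : ℝ :=
  potential C k f S - potential C k f (insert (x, b) S)

open Classical in
/-- The output of the potential learner with score `f` and threshold `α` on the instance `x` after
the labeled history `S`; `none` is the abstention `⊥`. If both labels maximize the potential drop,
then `tie` is taken as the maximizer `b⋆`. -/
noncomputable def potentialLearner {X : Type*} (C : Set (X → ℤˣ)) (k : ℕ)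
    (f : Finset (X × ℤˣ) → Set (X → ℤˣ) → ℝ) (α : ℝ) (tie : ℤˣ)
    (S : Finset (X × ℤˣ)) (x : X) : Option ℤˣ :=
  if restrictTo (versionSpace C (S : Set (X × ℤˣ))) x 1 = ∅ then some (-1)
  else if restrictTo (versionSpace C (S : Set (X × ℤˣ))) x (-1) = ∅ then some 1
  else if α ≤ max (potentialDrop C k f S x 1) (potentialDrop C k f S x (-1)) then
    let bstar : ℤˣ :=
      if potentialDrop C k f S x tie < potentialDrop C k f S x (-tie) then -tie else tie
    some (-bstar)
  else none

/-! ## The adversarial injection model -/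

/-- The record of one round: the instance `x_t`, whether it was injected (`q_t = 1`), the output of
the learner (`none` for an abstention), and the true label. -/
structure Round (X : Type*) where
  inst : X
  injected : Bool
  pred : Option ℤˣ
  label : ℤˣ

/-- The product σ-algebra, with the discrete one on the three finite components. -/
instance Round.instMeasurableSpace {X : Type*} [mX : MeasurableSpace X] :
    MeasurableSpace (Round X) :=
  MeasurableSpace.comap Round.inst mX ⊔
    MeasurableSpace.comap (fun ρ : Round X => (ρ.injected, ρ.pred, ρ.label)) ⊤

/-- A randomized adaptive adversary with private random seed in `R`: in round `t` (counted from
`0`), from the seed and the full record of the rounds before `t`, it chooses the bit `q_t`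
(`inject`) and the point that it injects if `q_t = 1` (`point`). -/
structure Adversary (R X : Type*) [MeasurableSpace R] [MeasurableSpace X] where
  inject : (t : ℕ) → R → (Fin t → Round X) → Bool
  point : (t : ℕ) → R → (Fin t → Round X) → X
  measurable_inject : ∀ t, Measurable fun p : R × (Fin t → Round X) => inject t p.1 p.2
  measurable_point : ∀ t, Measurable fun p : R × (Fin t → Round X) => point t p.1 p.2

open Classical in
/-- The set of labeled examples seen in the recorded rounds. -/
noncomputable def samples {X : Type*} {t : ℕ} (H : Fin t → Round X) : Finset (X × ℤˣ) :=
  Finset.univ.image fun s => ((H s).inst, (H s).label)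

/-- Round `t` of the protocol after the rounds `H`, with a (deterministic) learner, a target
concept, the adversary's seed `r`, and nature's fresh draw `x` for this round, which is the instance
if the adversary does not inject. -/
noncomputable def playRound {R X : Type*} [MeasurableSpace R] [MeasurableSpace X]
    (learner : Finset (X × ℤˣ) → X → Option ℤˣ) (target : X → ℤˣ) (adv : Adversary R X)
    (r : R) (t : ℕ) (H : Fin t → Round X) (x : X) : Round X :=
  let xt : X := if adv.inject t r H then adv.point t r H else x
  { inst := xt
    injected := adv.inject t r H
    pred := learner (samples H) xt
    label := target xt }

/-- The record of the first `t` rounds, where `z s` is nature's draw for round `s`. -/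
noncomputable def transcript {R X : Type*} [MeasurableSpace R] [MeasurableSpace X]
    (learner : Finset (X × ℤˣ) → X → Option ℤˣ) (target : X → ℤˣ) (adv : Adversary R X)
    (r : R) (z : ℕ → X) : (t : ℕ) → (Fin t → Round X)
  | 0 => Fin.elim0
  | t + 1 =>
      Fin.snoc (α := fun _ => Round X) (transcript learner target adv r z t)
        (playRound learner target adv r t (transcript learner target adv r z t) (z t))

/-- The number of misclassifications. -/
def errMis {X : Type*} {T : ℕ} (H : Fin T → Round X) : ℕ :=
  (Finset.univ.filter fun t => (H t).pred ≠ some (H t).label ∧ (H t).pred ≠ none).card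

/-- The number of incorrect abstentions, that is, abstentions on rounds that were not injected. -/
def errAbs {X : Type*} {T : ℕ} (H : Fin T → Round X) : ℕ :=
  (Finset.univ.filter fun t => (H t).pred = none ∧ (H t).injected = false).card

/-- The combined error in `T` rounds, as a function of the seed and of nature's draws. -/
noncomputable def combinedError {R X : Type*} [MeasurableSpace R] [MeasurableSpace X]
    (learner : Finset (X × ℤˣ) → X → Option ℤˣ) (target : X → ℤˣ) (adv : Adversary R X)
    (T : ℕ) (ω : R × (ℕ → X)) : ℝ :=
  (errMis (transcript learner target adv ω.1 ω.2 T) : ℝ) +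
    (errAbs (transcript learner target adv ω.1 ω.2 T) : ℝ)

/-- The joint law of the adversary's seed and of nature's draws: the seed has law `ν`, the draws are
i.i.d. with law `D`, and independent of the seed. -/
noncomputable def injectionLaw {R X : Type*} [MeasurableSpace R] [MeasurableSpace X]
    (ν : Measure R) (D : Measure X) [IsProbabilityMeasure D] : Measure (R × (ℕ → X)) :=
  ν.prod (Measure.infinitePi fun _ : ℕ => D)

/-! ## Axis-aligned rectangles containing the origin in the nonnegative orthant -/

open Classical in
/-- The concept `h_v`: `+1` on the points that are at most `v` in every coordinate. -/
noncomputable def rectConcept {d : ℕ} (v : Fin d → ℝ≥0) : (Fin d → ℝ≥0) → ℤˣ :=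
  fun x => if ∀ i, x i ≤ v i then 1 else -1

/-- The class of axis-aligned rectangles containing the origin. -/
def rectangles (d : ℕ) : Set ((Fin d → ℝ≥0) → ℤˣ) :=
  Set.range rectConcept

/-- The score of the singleton `{(x, y)}`: the number of coordinates `i` for which `(δ_i(x), -1)` is
realizable in `V_{x → y}`. Here `δ_i(x) = Pi.single i (x i)` is `x i` in coordinate `i` and `0` in
all others. -/
noncomputable def rectPointScore {d : ℕ} (z : (Fin d → ℝ≥0) × ℤˣ)
    (V : Set ((Fin d → ℝ≥0) → ℤˣ)) : ℕ :=
  {i : Fin d | (restrictTo (restrictTo V z.1 z.2) (Pi.single i (z.1 i)) (-1)).Nonempty}.ncard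

/-- The score `f_rect`. It is meant for singletons `U`, where the sum has a single term. -/
noncomputable def rectScore (d : ℕ) (U : Finset ((Fin d → ℝ≥0) × ℤˣ))
    (V : Set ((Fin d → ℝ≥0) → ℤˣ)) : ℝ :=
  ∑ z ∈ U, (rectPointScore z V : ℝ)

/-! ## Rectangles and their version spaces -/

/-! Two geometric facts drive everything. A point lying in each coordinate below some known positive
example is itself positive (`restrictTo_eq_empty_of_dominated`). If two negatives are cut off by the
same face of the target, then labeling the outer one positive kills that coordinate of the inner
one's score (`rectPointScore_restrictTo_lt`). Goodness follows by pigeonhole over the `d`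
coordinates. The error bound does not pass through robustness but uses the same two facts directly.

Mistakes: the potential starts at 0, stays nonnegative, grows by at most `d` per round, and falls by
at least `α` at each mistake. So there are at most `d * T / α` mistakes (`mistakes_le`).

Wrong abstentions: injected examples carry true labels, so they cannot undo domination by earlier
fresh points or the drop those points force. Hence an abstention on a fresh draw means that this
draw is exceptional among the fresh draws so far (`outlying_of_abstention`): it is a strict positive
maximum in some coordinate, or a negative with few distinct negatives below it at a common face. At
most `d * (L + 2)` indices of any sample are exceptional (`card_outlying_le`), with `L` about `α +
d`, so by exchangeability the last of `n + 1` i.i.d. points is so with probability at most `d * (L +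
2) / (n + 1)` (`prob_outlying_le`).

The adversary decides adaptively which rounds are fresh, but without seeing the current draw. The
fresh draws, completed by an independent ghost sample, therefore form an i.i.d. sequence
(`lintegral_mergedSample`). Summing over `n` gives `d * (L + 2) * (1 + log T)`, and `α = √T`
balances the two kinds of error. -/

theorem rectConcept_eq_one_iff {d : ℕ} {v x : Fin d → ℝ≥0} :
    rectConcept v x = 1 ↔ ∀ i, x i ≤ v i := by
  unfold rectConcept
  split_ifs with h
  · simpa using h
  · simpa using h

theorem rectConcept_eq_neg_one_iff {d : ℕ} {v x : Fin d → ℝ≥0} :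
    rectConcept v x = -1 ↔ ∃ i, v i < x i := by
  unfold rectConcept
  split_ifs with h
  · simpa using h
  · simpa using h

theorem rectConcept_single {d : ℕ} {v x : Fin d → ℝ≥0} {i : Fin d} :
    rectConcept v (Pi.single i (x i)) = -1 ↔ v i < x i := by
  rw [rectConcept_eq_neg_one_iff]
  constructor
  · rintro ⟨j, hj⟩
    by_cases h : j = i
    · subst h
      simpa using hj
    · simp [Pi.single_eq_of_ne h] at hj
  · exact fun h => ⟨i, by simpa using h⟩

theorem units_eq_neg_one_of_ne_one {y : ℤˣ} (h : y ≠ 1) : y = -1 :=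
  (Int.units_eq_one_or y).resolve_left h

theorem restrictTo_versionSpace {X : Type*} (C : Set (X → ℤˣ)) (S : Set (X × ℤˣ)) (x : X) (b : ℤˣ) :
    restrictTo (versionSpace C S) x b = versionSpace C (insert (x, b) S) := by
  ext h
  simp only [restrictTo, versionSpace, Set.mem_ofPred_eq, Set.mem_insert_iff, forall_eq_or_imp]
  tauto

theorem versionSpace_anti {X : Type*} (C : Set (X → ℤˣ)) {S S' : Set (X × ℤˣ)} (h : S ⊆ S') :
    versionSpace C S' ⊆ versionSpace C S :=
  fun _ hg => ⟨hg.1, fun z hz => hg.2 z (h hz)⟩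

theorem rectPointScore_le {d : ℕ} (z : (Fin d → ℝ≥0) × ℤˣ) (V : Set ((Fin d → ℝ≥0) → ℤˣ)) :
    rectPointScore z V ≤ d := by
  unfold rectPointScore
  refine (Set.ncard_le_ncard (Set.subset_univ _) Set.finite_univ).trans ?_
  simp [Set.ncard_univ]

theorem rectPointScore_mono {d : ℕ} (z : (Fin d → ℝ≥0) × ℤˣ) {V V' : Set ((Fin d → ℝ≥0) → ℤˣ)}
    (h : V ⊆ V') : rectPointScore z V ≤ rectPointScore z V' := by
  refine Set.ncard_le_ncard ?_ (Set.toFinite _)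
  rintro i ⟨g, ⟨hg, h1⟩, h2⟩
  exact ⟨g, ⟨h hg, h1⟩, h2⟩

/-- Two negative examples cut off by the same face: relabeling the outer one destroys that
coordinate of the score of the inner one. -/
theorem rectPointScore_restrictTo_lt {d : ℕ} {v u x : Fin d → ℝ≥0} {i : Fin d}
    {V : Set ((Fin d → ℝ≥0) → ℤˣ)} (hV : V ⊆ rectangles d) (hv : rectConcept v ∈ V)
    (hu : v i < u i) (hux : u i ≤ x i) :
    rectPointScore (u, -1) (restrictTo V x 1) + 1 ≤ rectPointScore (u, -1) V := by
  refine Set.ncard_lt_ncard ?_ (Set.toFinite _)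
  refine Set.ssubset_iff_exists.2 ⟨?_, i, ?_, ?_⟩
  · rintro j ⟨g, ⟨hg, h1⟩, h2⟩
    exact ⟨g, ⟨hg.1, h1⟩, h2⟩
  · exact ⟨_, ⟨hv, rectConcept_eq_neg_one_iff.2 ⟨i, hu⟩⟩, rectConcept_single.2 hu⟩
  · rintro ⟨g, ⟨⟨hg, h1⟩, -⟩, h2⟩
    obtain ⟨v', rfl⟩ := hV hg
    have h3 := rectConcept_eq_one_iff.1 h1 i
    have h4 : v' i < u i := rectConcept_single.1 h2
    exact absurd (h4.trans_le (hux.trans h3)) (lt_irrefl _)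

theorem rectScore_singleton {d : ℕ} (z : (Fin d → ℝ≥0) × ℤˣ) (V : Set ((Fin d → ℝ≥0) → ℤˣ)) :
    rectScore d {z} V = rectPointScore z V := by
  simp [rectScore]

/-- A point below the coordinatewise maximum of positive examples is positive. -/
theorem restrictTo_eq_empty_of_dominated {d : ℕ} {S : Set ((Fin d → ℝ≥0) × ℤˣ)}
    {x : Fin d → ℝ≥0} (hx : ∀ i, ∃ z ∈ S, z.2 = 1 ∧ x i ≤ z.1 i) :
    restrictTo (versionSpace (rectangles d) S) x (-1) = ∅ := by
  rw [Set.eq_empty_iff_forall_notMem]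
  rintro _ ⟨⟨⟨v, rfl⟩, hS⟩, h⟩
  obtain ⟨i, hi⟩ := rectConcept_eq_neg_one_iff.1 h
  obtain ⟨z, hz, hz1, hxz⟩ := hx i
  have h1 := rectConcept_eq_one_iff.1 ((hS z hz).trans hz1) i
  exact absurd (hi.trans_le (hxz.trans h1)) (lt_irrefl _)

/-- Among `2 * d + 1` examples, more than `d` are positive or more than `d` are negative. In the
first case some positive example is dominated by the others, and flipping it leaves nothing
realizable. In the second case two negatives share a face of the target, and flipping the outer one
costs the inner one a coordinate. -/
theorem isGood_rectScore (d : ℕ) (hd : 1 ≤ d) :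
    IsGood (rectangles d) (rectScore d) (2 * d + 1) (d : ℝ) 1 where
  bounded U hU V _ := by
    obtain ⟨z, rfl⟩ := Finset.card_eq_one.1 hU
    rw [rectScore_singleton]
    exact ⟨by positivity, by exact_mod_cast rectPointScore_le z V⟩
  monotone U hU V _ x y _ := by
    obtain ⟨z, rfl⟩ := Finset.card_eq_one.1 hU
    rw [rectScore_singleton, rectScore_singleton]
    exact_mod_cast rectPointScore_mono z fun _ (h : _ ∈ restrictTo V x y) => h.1
  robust := by
    classical
    rintro _ ⟨v, rfl⟩ M hM hlab
    have hsplit := Finset.card_filter_add_card_filter_not (s := M) (fun z => z.2 = 1)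
    by_cases hpos : d < (M.filter fun z => z.2 = 1).card
    · set P := M.filter fun z => z.2 = 1 with hP
      have hne : P.Nonempty := Finset.card_pos.1 (by omega)
      choose g hgP hg using fun i : Fin d => Finset.exists_max_image P (fun z => z.1 i) hne
      have hcard : (Finset.univ.image g).card < P.card :=
        (Finset.card_image_le.trans (by simp)).trans_lt hpos
      obtain ⟨w, hwP, hw⟩ := Finset.exists_mem_notMem_of_card_lt_card hcard
      have hwM := (Finset.mem_filter.1 hwP).1
      -- Any other example serves as `U`, even a coordinate maximizer: although `A` may omit it,
      -- realizability of `U` puts it back.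
      obtain ⟨u, huM, huw⟩ := Finset.exists_mem_ne (s := M) (by omega) w
      refine ⟨{u}, by simpa using huM, by simp, w, hwM, by simpa using huw.symm, ?_⟩
      intro A _ hMA
      right
      rintro ⟨h, ⟨hV, hhw⟩, hU⟩
      have hw1 : w.2 = 1 := (Finset.mem_filter.1 hwP).2
      have hmem : h ∈ restrictTo (versionSpace (rectangles d) (M \ {w} : Set _)) w.1 (-1) := by
        refine ⟨⟨hV.1, fun z hz => ?_⟩, by rw [hhw, hw1]⟩
        by_cases hzu : z = u
        · exact hU z (by simp [hzu])
        · exact hV.2 z (hMA ⟨hz.1, by simpa [hzu] using hz.2⟩)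
      rw [restrictTo_eq_empty_of_dominated] at hmem
      · exact hmem
      · intro i
        refine ⟨g i, ⟨(Finset.mem_filter.1 (hgP i)).1, ?_⟩, (Finset.mem_filter.1 (hgP i)).2,
          hg i w hwP⟩
        intro h
        exact hw (Finset.mem_image.2 ⟨i, Finset.mem_univ _, h⟩)
    · set N := M.filter fun z => ¬ z.2 = 1 with hN
      have hNcard : d < N.card := by omega
      have hNi : ∀ z ∈ N, ∃ i, v i < z.1 i := by
        intro z hz
        obtain ⟨hzM, hz1⟩ := Finset.mem_filter.1 hz
        exact rectConcept_eq_neg_one_iff.1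
          ((hlab z hzM).trans (units_eq_neg_one_of_ne_one hz1))
      have : Nonempty (Fin d) := ⟨⟨0, hd⟩⟩
      -- `c` picks a face of the target that cuts off each negative; with more than `d` negatives,
      -- two share a face.
      choose! c hc using hNi
      obtain ⟨a, ha, b, hb, hab, hcab⟩ :=
        Finset.exists_ne_map_eq_of_card_lt_of_maps_to (s := N) (t := Finset.univ) (f := c)
          (by simpa using hNcard) (fun _ _ => Finset.mem_coe.2 (Finset.mem_univ _))
      have key : ∀ u ∈ N, ∀ w ∈ N, u ≠ w → c u = c w → u.1 (c u) ≤ w.1 (c u) →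
          ∃ U : Finset ((Fin d → ℝ≥0) × ℤˣ), U ⊆ M ∧ U.card = 1 ∧ ∃ w ∈ M, w ∉ U ∧
          ∀ A : Set ((Fin d → ℝ≥0) × ℤˣ), (∀ z ∈ A, rectConcept v z.1 = z.2) →
            (M : Set ((Fin d → ℝ≥0) × ℤˣ)) \ ((U : Set ((Fin d → ℝ≥0) × ℤˣ)) ∪ {w}) ⊆ A →
            1 ≤ rectScore d U (versionSpace (rectangles d) A) -
              rectScore d U (restrictTo (versionSpace (rectangles d) A) w.1 (-w.2)) ∨
              ¬ RealizableIn (U : Set ((Fin d → ℝ≥0) × ℤˣ))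
                (restrictTo (versionSpace (rectangles d) A) w.1 (-w.2)) := by
        intro u hu w hw huw hcuw hle
        obtain ⟨huM, hu1⟩ := Finset.mem_filter.1 hu
        obtain ⟨hwM, hw1⟩ := Finset.mem_filter.1 hw
        refine ⟨{u}, by simpa using huM, by simp, w, hwM, by simpa using huw.symm, ?_⟩
        intro A hA _
        left
        obtain ⟨ux, uy⟩ := u
        obtain rfl : uy = -1 := units_eq_neg_one_of_ne_one hu1
        rw [rectScore_singleton, rectScore_singleton, units_eq_neg_one_of_ne_one hw1, neg_neg]
        have := rectPointScore_restrictTo_lt (V := versionSpace (rectangles d) A)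
          (fun _ h => h.1) ⟨⟨v, rfl⟩, hA⟩ (hc _ hu) hle
        have h2 : ((rectPointScore (ux, -1) (restrictTo (versionSpace (rectangles d) A) w.1 1) : ℕ)
          : ℝ) + 1 ≤ rectPointScore (ux, -1) (versionSpace (rectangles d) A) := by
          exact_mod_cast this
        linarith
      rcases le_total (a.1 (c a)) (b.1 (c a)) with h | h
      · exact key a ha b hb hab hcab h
      · exact key b hb a ha hab.symm hcab.symm (by rwa [← hcab])

/-! ## The leave-one-out potential of rectangles -/

/-- It suffices to test the smallest rectangle containing the positives. This turns realizability
into finitely many coordinate comparisons, which later gives measurability. -/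
theorem versionSpace_rectangles_nonempty_iff {d : ℕ} (S : Finset ((Fin d → ℝ≥0) × ℤˣ)) :
    (versionSpace (rectangles d) (S : Set ((Fin d → ℝ≥0) × ℤˣ))).Nonempty ↔
      ∀ z ∈ S, z.2 = -1 → ∃ i, 0 < z.1 i ∧ ∀ p ∈ S, p.2 = 1 → p.1 i < z.1 i := by
  constructor
  · rintro ⟨_, ⟨v, rfl⟩, hS⟩ z hz hz1
    obtain ⟨i, hi⟩ := rectConcept_eq_neg_one_iff.1 ((hS z hz).trans hz1)
    exact ⟨i, pos_of_gt hi, fun p hp hp1 =>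
      (rectConcept_eq_one_iff.1 ((hS p hp).trans hp1) i).trans_lt hi⟩
  · intro h
    -- With no positives this supremum is 0, whence the condition `0 < z.1 i`.
    refine ⟨_, ⟨fun i => (S.filter fun z => z.2 = 1).sup fun z => z.1 i, rfl⟩, fun z hz => ?_⟩
    rcases Int.units_eq_one_or z.2 with hz1 | hz1
    · rw [hz1, rectConcept_eq_one_iff]
      exact fun i => Finset.le_sup (f := fun z : (Fin d → ℝ≥0) × ℤˣ => z.1 i)
        (Finset.mem_filter.2 ⟨hz, hz1⟩)
    · rw [hz1, rectConcept_eq_neg_one_iff]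
      obtain ⟨i, hi, hp⟩ := h z hz hz1
      refine ⟨i, (Finset.sup_lt_iff (by simpa using hi)).2 fun p hpS => ?_⟩
      exact hp p (Finset.mem_filter.1 hpS).1 (Finset.mem_filter.1 hpS).2

/-- The score of `z` against the version space of `S`, when `z` belongs to `S`. -/
noncomputable def cutCount {d : ℕ} (S : Set ((Fin d → ℝ≥0) × ℤˣ)) (x : Fin d → ℝ≥0) : ℕ :=
  {i : Fin d | (versionSpace (rectangles d) (insert (Pi.single i (x i), -1) S)).Nonempty}.ncard

theorem rectPointScore_versionSpace {d : ℕ} (S : Set ((Fin d → ℝ≥0) × ℤˣ))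
    (z : (Fin d → ℝ≥0) × ℤˣ) :
    rectPointScore z (versionSpace (rectangles d) S) = cutCount (insert z S) z.1 := by
  unfold rectPointScore cutCount
  simp only [restrictTo_versionSpace]

/-- The score of `z` restricts to `z` again, which restores the example that was left out. Every
summand therefore sees the same set `S`. -/
theorem potential_rectScore {d : ℕ} (S : Finset ((Fin d → ℝ≥0) × ℤˣ)) :
    potential (rectangles d) 1 (rectScore d) S = ∑ z ∈ S, (cutCount (S : Set _) z.1 : ℝ) := by
  unfold potential
  rw [Finset.powersetCard_one, Finset.sum_map]
  refine Finset.sum_congr rfl fun z hz => ?_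
  simp only [Function.Embedding.coeFn_mk]
  rw [rectScore_singleton, rectPointScore_versionSpace, Finset.coe_singleton,
    Set.insert_sdiff_singleton, Set.insert_eq_of_mem (Finset.mem_coe.2 hz)]

theorem cutCount_anti {d : ℕ} {S S' : Set ((Fin d → ℝ≥0) × ℤˣ)} (h : S ⊆ S')
    (x : Fin d → ℝ≥0) : cutCount S' x ≤ cutCount S x :=
  Set.ncard_le_ncard (fun _ hi => hi.mono (versionSpace_anti _ (Set.insert_subset_insert h)))
    (Set.toFinite _)

theorem cutCount_le {d : ℕ} (S : Set ((Fin d → ℝ≥0) × ℤˣ)) (x : Fin d → ℝ≥0) :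
    cutCount S x ≤ d := by
  refine (Set.ncard_le_ncard (Set.subset_univ _) Set.finite_univ).trans ?_
  simp [Set.ncard_univ]

theorem potential_rectScore_nonneg {d : ℕ} (S : Finset ((Fin d → ℝ≥0) × ℤˣ)) :
    0 ≤ potential (rectangles d) 1 (rectScore d) S := by
  rw [potential_rectScore]
  positivity

theorem potential_rectScore_insert_le {d : ℕ} [DecidableEq ((Fin d → ℝ≥0) × ℤˣ)] (S : Finset ((Fin d → ℝ≥0) × ℤˣ))
    (z : (Fin d → ℝ≥0) × ℤˣ) :
    potential (rectangles d) 1 (rectScore d) (insert z S) ≤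
      potential (rectangles d) 1 (rectScore d) S + d := by
  by_cases hz : z ∈ S
  · rw [Finset.insert_eq_of_mem hz]
    simp
  rw [potential_rectScore, potential_rectScore, Finset.sum_insert hz, add_comm]
  refine add_le_add (Finset.sum_le_sum fun u _ => ?_) ?_
  · exact_mod_cast cutCount_anti (by simp) u.1
  · exact_mod_cast cutCount_le _ _

/-- Many inner negative examples in the same direction force a large potential drop. -/
theorem card_le_potential_sub_add {d : ℕ} [DecidableEq ((Fin d → ℝ≥0) × ℤˣ)] {v x : Fin d → ℝ≥0} {i : Fin d}
    {S J : Finset ((Fin d → ℝ≥0) × ℤˣ)} (hS : ∀ z ∈ S, rectConcept v z.1 = z.2)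
    (hx : v i < x i) (hJS : J ⊆ S) (hJ : ∀ z ∈ J, v i < z.1 i ∧ z.1 i ≤ x i) :
    (J.card : ℝ) ≤ potential (rectangles d) 1 (rectScore d) S -
      potential (rectangles d) 1 (rectScore d) (insert (x, 1) S) + d := by
  -- The hypothetical example has the wrong label, so it is new and contributes its own term of at
  -- most `d`: this is the `+ d`.
  have hxS : (x, (1 : ℤˣ)) ∉ S := fun h =>
    absurd (rectConcept_eq_one_iff.1 (hS _ h) i) (not_le.2 hx)
  rw [potential_rectScore, potential_rectScore, Finset.sum_insert hxS]
  have h1 : (cutCount ((insert (x, (1 : ℤˣ)) S : Finset _) : Set _) (x, (1 : ℤˣ)).1 : ℝ) ≤ d := by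
    exact_mod_cast cutCount_le _ _
  have h2 : (J.card : ℝ) ≤ ∑ z ∈ S, ((cutCount (S : Set _) z.1 : ℝ) -
      (cutCount ((insert (x, (1 : ℤˣ)) S : Finset _) : Set _) z.1 : ℝ)) := by
    have h3 : ∀ z ∈ S, (0 : ℝ) ≤ (cutCount (S : Set _) z.1 : ℝ) -
      (cutCount ((insert (x, (1 : ℤˣ)) S : Finset _) : Set _) z.1 : ℝ) := by
      intro z _
      rw [sub_nonneg]
      exact_mod_cast cutCount_anti (by simp) z.1
    refine le_trans ?_ (Finset.sum_le_sum_of_subset_of_nonneg hJS fun z hz _ => h3 z hz)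
    rw [Finset.card_eq_sum_ones, Nat.cast_sum]
    refine Finset.sum_le_sum fun z hz => ?_
    obtain ⟨hvz, hzx⟩ := hJ z hz
    have hz1 : z = (z.1, -1) := by
      refine Prod.ext rfl ?_
      rw [← hS z (hJS hz)]
      exact rectConcept_eq_neg_one_iff.2 ⟨i, hvz⟩
    have h4 := rectPointScore_restrictTo_lt (V := versionSpace (rectangles d) (S : Set _))
      (fun _ h => h.1) ⟨⟨v, rfl⟩, fun z hz => hS z hz⟩ hvz hzx
    rw [restrictTo_versionSpace, rectPointScore_versionSpace, rectPointScore_versionSpace, ← hz1,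
      Set.insert_eq_of_mem (Finset.mem_coe.2 (hJS hz)), Set.insert_eq_of_mem
      (Set.mem_insert_of_mem _ (Finset.mem_coe.2 (hJS hz)))] at h4
    have h5 : (cutCount (insert (x, (1 : ℤˣ)) (S : Set _)) z.1 : ℝ) + 1 ≤
      cutCount (S : Set _) z.1 := by exact_mod_cast h4
    rw [Finset.coe_insert]
    push_cast
    linarith
  rw [Finset.sum_sub_distrib] at h2
  linarith

/-! ## Mistakes and abstentions of the potential learner -/

/-- The target survives in the version space, so a forced prediction is never wrong. A mistake thus
comes from the potential rule, and then `b⋆`, the label opposite to the prediction, is the true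
label and attains the maximal drop. -/
theorem le_potentialDrop_of_mistake {X : Type*} {C : Set (X → ℤˣ)} {k : ℕ}
    {f : Finset (X × ℤˣ) → Set (X → ℤˣ) → ℝ} {α : ℝ} {tie : ℤˣ} {S : Finset (X × ℤˣ)} {x : X}
    {h : X → ℤˣ} (hC : h ∈ C) (hS : ∀ z ∈ S, h z.1 = z.2)
    (h1 : potentialLearner C k f α tie S x ≠ some (h x))
    (h2 : potentialLearner C k f α tie S x ≠ none) :
    α ≤ potentialDrop C k f S x (h x) := by
  have hmem : ∀ b, h x = b → (restrictTo (versionSpace C (S : Set (X × ℤˣ))) x b).Nonempty :=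
    fun b hb => ⟨h, ⟨hC, hS⟩, hb⟩
  unfold potentialLearner at h1 h2
  split_ifs at h1 h2 with c1 c2 c3
  · have := (Int.units_eq_one_or (h x)).resolve_right fun e => h1 (by rw [e])
    exact absurd c1 (hmem 1 this).ne_empty
  · have := (Int.units_eq_one_or (h x)).resolve_left fun e => h1 (by rw [e])
    exact absurd c2 (hmem (-1) this).ne_empty
  · simp only [ne_eq, Option.some.injEq] at h1
    have hmax := le_max_iff.1 c3
    rcases Int.units_eq_one_or (h x) with e | e <;> rcases Int.units_eq_one_or tie with e' | e' <;>
      simp_all <;> rcases hmax with c5 | c5 <;> linarith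
  · simp only [ne_eq, Option.some.injEq] at h1
    have hmax := le_max_iff.1 c3
    rcases Int.units_eq_one_or (h x) with e | e <;> rcases Int.units_eq_one_or tie with e' | e' <;>
      simp_all <;> rcases hmax with c5 | c5 <;> linarith
  · exact absurd rfl h2

theorem potential_insert_add_le_of_mistake {X : Type*} [DecidableEq (X × ℤˣ)]
    {C : Set (X → ℤˣ)} {k : ℕ}
    {f : Finset (X × ℤˣ) → Set (X → ℤˣ) → ℝ} {α : ℝ} {tie : ℤˣ} {S : Finset (X × ℤˣ)} {x : X}
    {h : X → ℤˣ} (hC : h ∈ C) (hS : ∀ z ∈ S, h z.1 = z.2)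
    (h1 : potentialLearner C k f α tie S x ≠ some (h x))
    (h2 : potentialLearner C k f α tie S x ≠ none) :
    potential C k f (insert (x, h x) S) + α ≤ potential C k f S := by
  have h3 : α ≤ potential C k f S - potential C k f (insert (x, h x) S) := by
    convert le_potentialDrop_of_mistake hC hS h1 h2
    unfold potentialDrop
    congr!
  linarith

/-- Only the drop for label `1` is recorded: the analysis of a negative point tests the hypothetical
positive label. -/
theorem potentialLearner_eq_none {X : Type*} {C : Set (X → ℤˣ)} {k : ℕ}
    {f : Finset (X × ℤˣ) → Set (X → ℤˣ) → ℝ} {α : ℝ} {tie : ℤˣ} {S : Finset (X × ℤˣ)} {x : X}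
    (h : potentialLearner C k f α tie S x = none) :
    (∀ b, (restrictTo (versionSpace C (S : Set (X × ℤˣ))) x b).Nonempty) ∧
      potentialDrop C k f S x 1 < α := by
  unfold potentialLearner at h
  split_ifs at h with c1 c2 c3
  refine ⟨fun b => ?_, (max_lt_iff.1 (not_le.1 c3)).1⟩
  rcases Int.units_eq_one_or b with rfl | rfl
  · exact Set.nonempty_iff_ne_empty.2 c1
  · exact Set.nonempty_iff_ne_empty.2 c2

theorem samples_snoc {X : Type*} [DecidableEq (X × ℤˣ)] {t : ℕ} (H : Fin t → Round X)
    (ρ : Round X) :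
    samples (Fin.snoc (α := fun _ => Round X) H ρ) = insert (ρ.inst, ρ.label) (samples H) := by
  ext z
  simp [samples, Fin.exists_fin_succ', eq_comm, or_comm]

theorem errMis_snoc {X : Type*} {t : ℕ} (H : Fin t → Round X) (ρ : Round X) :
    errMis (Fin.snoc (α := fun _ => Round X) H ρ) = errMis H +
      if ρ.pred ≠ some ρ.label ∧ ρ.pred ≠ none then 1 else 0 := by
  unfold errMis
  rw [Finset.card_filter, Finset.card_filter, Fin.sum_univ_castSucc]
  simp only [Fin.snoc_castSucc, Fin.snoc_last]

theorem errAbs_snoc {X : Type*} {t : ℕ} (H : Fin t → Round X) (ρ : Round X) :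
    errAbs (Fin.snoc (α := fun _ => Round X) H ρ) = errAbs H +
      if ρ.pred = none ∧ ρ.injected = false then 1 else 0 := by
  unfold errAbs
  rw [Finset.card_filter, Finset.card_filter, Fin.sum_univ_castSucc]
  simp only [Fin.snoc_castSucc, Fin.snoc_last]

theorem errMis_add_errAbs_le {X : Type*} {T : ℕ} (H : Fin T → Round X) :
    errMis H + errAbs H ≤ T := by
  unfold errMis errAbs
  rw [← Finset.card_union_of_disjoint]
  · exact (Finset.card_le_univ _).trans (by simp)
  · exact Finset.disjoint_filter.2 fun t _ h h' => h.2 h'.1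

section Protocol

variable {R X : Type*} [MeasurableSpace R] [MeasurableSpace X]

theorem label_of_mem_samples_transcript {learner : Finset (X × ℤˣ) → X → Option ℤˣ}
    {target : X → ℤˣ} {adv : Adversary R X} {r : R} {z : ℕ → X} {t : ℕ} :
    ∀ p ∈ samples (transcript learner target adv r z t), target p.1 = p.2 := by
  classical
  induction t with
  | zero => simp [samples]
  | succ t ih =>
    intro p hp
    rw [transcript, samples_snoc, Finset.mem_insert] at hp
    rcases hp with rfl | hp
    · rfl
    · exact ih p hp

/-- Causality: the first `t` rounds do not see the draws from `t` on. This is what makes the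
injection decision independent of the current draw. -/
theorem transcript_update {learner : Finset (X × ℤˣ) → X → Option ℤˣ}
    {target : X → ℤˣ} {adv : Adversary R X} {r : R} {z : ℕ → X} {t s : ℕ} (hst : t ≤ s) (x : X) :
    transcript learner target adv r (Function.update z s x) t =
      transcript learner target adv r z t := by
  induction t with
  | zero => rfl
  | succ t ih =>
    rw [transcript, transcript, ih (by omega), Function.update_of_ne (by omega)]

end Protocol

theorem mistakes_le {d : ℕ} {R : Type*} [MeasurableSpace R] {target : (Fin d → ℝ≥0) → ℤˣ}
    (ht : target ∈ rectangles d) {α : ℝ} {tie : ℤˣ} (adv : Adversary R (Fin d → ℝ≥0)) (r : R)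
    (z : ℕ → Fin d → ℝ≥0) (T : ℕ) :
    α * errMis (transcript (potentialLearner (rectangles d) 1 (rectScore d) α tie)
      target adv r z T) ≤ d * T := by
  classical
  -- Amortization: keeping the potential on the left makes the induction close, since a drop of `α`
  -- pays for each mistake.
  suffices h : potential (rectangles d) 1 (rectScore d) (samples (transcript
      (potentialLearner (rectangles d) 1 (rectScore d) α tie) target adv r z T)) +
      α * errMis (transcript (potentialLearner (rectangles d) 1 (rectScore d) α tie)
        target adv r z T) ≤ d * T by
    have := potential_rectScore_nonneg (samples (transcript
      (potentialLearner (rectangles d) 1 (rectScore d) α tie) target adv r z T))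
    linarith
  induction T with
  | zero => simp [samples, errMis, potential_rectScore]
  | succ T ih =>
    rw [transcript, samples_snoc, errMis_snoc]
    generalize hH : transcript (potentialLearner (rectangles d) 1 (rectScore d) α tie)
      target adv r z T = H at ih ⊢
    have hlab : ∀ p ∈ samples H, target p.1 = p.2 := hH ▸ label_of_mem_samples_transcript
    split_ifs with hm
    · have := potential_insert_add_le_of_mistake ht hlab hm.1 hm.2
      have h0 : (0 : ℝ) ≤ d := by positivity
      simp only [playRound] at this ⊢
      push_cast
      linarith
    · have := potential_rectScore_insert_le (samples H)
        ((playRound (potentialLearner (rectangles d) 1 (rectScore d) α tie) target adv r T H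
          (z T)).inst, (playRound (potentialLearner (rectangles d) 1 (rectScore d) α tie) target
          adv r T H (z T)).label)
      push_cast
      linarith

/-! ## Outlying indices of a sample -/

/-- Among the points `w 0, …, w n`, the point with index `j` is a positive example that exceeds
all other positive ones in the coordinate `i`. -/
def PositivePeak {d : ℕ} (v : Fin d → ℝ≥0) (n : ℕ) (w : ℕ → Fin d → ℝ≥0) (j : ℕ) (i : Fin d) :
    Prop :=
  rectConcept v (w j) = 1 ∧
      ∀ k ∈ Finset.range (n + 1), k ≠ j → rectConcept v (w k) = 1 → w k i < w j i

/-- Among the points `w 0, …, w n`, the point with index `j` occurs only once, is cut off by the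
face `i` of the target, and so are at most `L` different ones weakly below it. -/
def ShallowNegative {d : ℕ} (v : Fin d → ℝ≥0) (L n : ℕ) (w : ℕ → Fin d → ℝ≥0) (j : ℕ)
    (i : Fin d) : Prop :=
  v i < w j i ∧ (∀ k ∈ Finset.range (n + 1), k ≠ j → w k ≠ w j) ∧
      ∀ J ∈ (Finset.range (n + 1)).powerset, j ∉ J → (∀ k ∈ J, v i < w k i ∧ w k i ≤ w j i) →
        (∀ k ∈ J, ∀ l ∈ J, w k = w l → k = l) → J.card ≤ L

/-- The indices of a sample on which an adversary can make the learner abstain. -/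
def Outlying {d : ℕ} (v : Fin d → ℝ≥0) (L n : ℕ) (w : ℕ → Fin d → ℝ≥0) (j : ℕ) : Prop :=
  ∃ i, PositivePeak v n w j i ∨ ShallowNegative v L n w j i

open Classical in
-- Per coordinate there is at most one strict positive maximum. For the shallow negatives, take the
-- topmost: all others lie weakly below it and are pairwise distinct, so there are at most `L` of
-- them.
theorem card_outlying_le {d : ℕ} (v : Fin d → ℝ≥0) (L n : ℕ) (w : ℕ → Fin d → ℝ≥0) :
    ((Finset.range (n + 1)).filter (Outlying v L n w)).card ≤ d * (L + 2) := by
  set A : Fin d → Finset ℕ := fun i => (Finset.range (n + 1)).filter fun j =>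
    PositivePeak v n w j i with hA
  set B : Fin d → Finset ℕ := fun i => (Finset.range (n + 1)).filter fun j =>
    ShallowNegative v L n w j i with hB
  have hAc : ∀ i, (A i).card ≤ 1 := by
    intro i
    refine Finset.card_le_one.2 fun a ha b hb => ?_
    obtain ⟨ha1, ha2, ha3⟩ := Finset.mem_filter.1 ha
    obtain ⟨hb1, hb2, hb3⟩ := Finset.mem_filter.1 hb
    by_contra hab
    exact lt_asymm (ha3 b hb1 (Ne.symm hab) hb2) (hb3 a ha1 hab ha2)
  have hBc : ∀ i, (B i).card ≤ L + 1 := by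
    intro i
    rcases (B i).eq_empty_or_nonempty with he | hne
    · simp [he]
    obtain ⟨j, hj, hmax⟩ := Finset.exists_max_image (B i) (fun j => w j i) hne
    obtain ⟨-, -, -, hj3⟩ := Finset.mem_filter.1 hj
    have := hj3 ((B i).erase j)
      (Finset.mem_powerset.2 ((Finset.erase_subset _ _).trans (Finset.filter_subset _ _)))
      (Finset.notMem_erase _ _)
      (fun k hk => ⟨(Finset.mem_filter.1 (Finset.mem_of_mem_erase hk)).2.1,
        hmax k (Finset.mem_of_mem_erase hk)⟩)
      (fun k hk l hl hkl => by
        by_contra hne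
        exact (Finset.mem_filter.1 (Finset.mem_of_mem_erase hl)).2.2.1 k
          (Finset.mem_filter.1 (Finset.mem_of_mem_erase hk)).1 hne hkl)
    rw [Finset.card_erase_of_mem hj] at this
    omega
  have hsub : (Finset.range (n + 1)).filter (Outlying v L n w) ⊆
      Finset.univ.biUnion fun i => A i ∪ B i := by
    intro j hj
    obtain ⟨hj1, i, hj2⟩ := Finset.mem_filter.1 hj
    refine Finset.mem_biUnion.2 ⟨i, Finset.mem_univ _, Finset.mem_union.2 ?_⟩
    exact hj2.imp (fun h => Finset.mem_filter.2 ⟨hj1, h⟩) fun h => Finset.mem_filter.2 ⟨hj1, h⟩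
  refine (Finset.card_le_card hsub).trans ?_
  refine (Finset.card_biUnion_le_card_mul _ _ (L + 2) fun i _ => ?_).trans (by simp)
  refine (Finset.card_union_le _ _).trans ?_
  have := hAc i
  have := hBc i
  omega

/-- An abstention on the point `w n` makes the index `n` outlying, whatever else has been injected
into the history `S`. -/
theorem outlying_of_abstention {d : ℕ} {v : Fin d → ℝ≥0} {α : ℝ} {tie : ℤˣ} {L n : ℕ}
    (hL : α + d ≤ L + 1) {S : Finset ((Fin d → ℝ≥0) × ℤˣ)}
    (hS : ∀ z ∈ S, rectConcept v z.1 = z.2) {w : ℕ → Fin d → ℝ≥0}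
    (hw : ∀ k < n, (w k, rectConcept v (w k)) ∈ S)
    (habs : potentialLearner (rectangles d) 1 (rectScore d) α tie S (w n) = none) :
    Outlying v L n w n := by
  classical
  obtain ⟨hne, hdrop⟩ := potentialLearner_eq_none habs
  rcases Int.units_eq_one_or (rectConcept v (w n)) with h1 | h1
  · by_contra hcon
    -- A positive point that is a peak in no coordinate is dominated by earlier fresh positives, so
    -- its label would be forced.
    refine (hne (-1)).ne_empty (restrictTo_eq_empty_of_dominated fun i => ?_)
    by_contra hno
    push Not at hno
    refine hcon ⟨i, Or.inl ⟨h1, fun k hk hkn hk1 => ?_⟩⟩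
    have hk' : k < n := by
      have := Finset.mem_range.1 hk
      omega
    exact hno (w k, rectConcept v (w k)) (hw k hk') hk1
  · obtain ⟨i, hi⟩ := rectConcept_eq_neg_one_iff.1 h1
    have hlt : ∀ k ∈ Finset.range (n + 1), k ≠ n → k < n := fun k hk hkn => by
      have := Finset.mem_range.1 hk
      omega
    refine ⟨i, Or.inr ⟨hi, fun k hk hkn heq => ?_, fun J hJ hnJ hJi hinj => ?_⟩⟩
    -- A repetition of an earlier fresh point has a known label and cannot cause an abstention.
    · obtain ⟨g, ⟨-, hg⟩, hg1⟩ := hne 1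
      have h2 := hg _ (hw k (hlt k hk hkn))
      simp only [heq, h1, hg1] at h2
      exact absurd h2 (by decide)
    · have hkJ : ∀ k ∈ J, k < n := fun k hk =>
        hlt k (Finset.mem_powerset.1 hJ hk) (fun h => hnJ (h ▸ hk))
      have h3 := card_le_potential_sub_add (J := J.image fun k => (w k, rectConcept v (w k)))
        hS hi (by
          intro z hz
          obtain ⟨k, hk, rfl⟩ := Finset.mem_image.1 hz
          exact hw k (hkJ k hk)) (by
          intro z hz
          obtain ⟨k, hk, rfl⟩ := Finset.mem_image.1 hz
          exact hJi k hk)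
      -- The potential runs over a set of examples, so repeated points count once; hence the
      -- distinctness condition on `J`.
      rw [Finset.card_image_of_injOn (fun k hk l hl hkl => hinj k hk l hl (Prod.ext_iff.1 hkl).1)]
        at h3
      have h4 : (J.card : ℝ) ≤ potentialDrop (rectangles d) 1 (rectScore d) S (w n) 1 + d := by
        unfold potentialDrop
        convert h3
      have h5 : (J.card : ℝ) < ((L + 1 : ℕ) : ℝ) := by
        push_cast
        linarith
      have := Nat.cast_lt.1 h5
      omega

/-! ## Resampling and permuting an i.i.d. sequence -/

section IID

variable {X : Type*} [MeasurableSpace X] (D : Measure X) [IsProbabilityMeasure D]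

theorem measurable_update_pair (t : ℕ) :
    Measurable fun p : (ℕ → X) × X => Function.update p.1 t p.2 := by
  refine measurable_pi_iff.2 fun k => ?_
  by_cases h : k = t
  · subst h
    simpa using measurable_snd
  · simp only [Function.update_of_ne h]
    fun_prop

/-- Replacing one coordinate by an independent copy preserves the product law: the preimage of a
cylinder is a product that moves the constraint on coordinate `t` to the new variable. -/
theorem map_update_infinitePi (t : ℕ) :
    ((Measure.infinitePi fun _ : ℕ => D).prod D).map
      (fun p : (ℕ → X) × X => Function.update p.1 t p.2) = Measure.infinitePi fun _ : ℕ => D := by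
  have hm := measurable_update_pair (X := X) t
  refine Measure.eq_infinitePi _ fun s B hB => ?_
  rw [Measure.map_apply hm (MeasurableSet.pi s.countable_toSet fun i _ => hB i)]
  have hpre : (fun p : (ℕ → X) × X => Function.update p.1 t p.2) ⁻¹' (Set.pi (s : Set ℕ) B) =
      (Set.pi ((s.erase t : Finset ℕ) : Set ℕ) B) ×ˢ (if t ∈ s then B t else Set.univ) := by
    ext ⟨z, x⟩
    simp only [Set.mem_preimage, Set.mem_pi, Set.mem_prod, Finset.mem_coe, Finset.mem_erase]
    constructor
    · intro h
      refine ⟨fun i hi => ?_, ?_⟩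
      · simpa [Function.update_of_ne hi.1] using h i hi.2
      · split_ifs with ht
        · simpa using h t ht
        · trivial
    · rintro ⟨h1, h2⟩ i hi
      by_cases hit : i = t
      · subst hit
        simpa [hi] using h2
      · simpa [Function.update_of_ne hit] using h1 i ⟨hit, hi⟩
  rw [hpre, Measure.prod_prod, Measure.infinitePi_pi _ fun i _ => hB i]
  split_ifs with ht
  · rw [Finset.prod_erase_mul _ _ ht]
  · rw [measure_univ, mul_one, Finset.erase_eq_of_notMem ht]

theorem lintegral_update_infinitePi (t : ℕ) {G : (ℕ → X) → ENNReal} (hG : Measurable G) :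
    ∫⁻ z, ∫⁻ x, G (Function.update z t x) ∂D ∂(Measure.infinitePi fun _ : ℕ => D) =
      ∫⁻ z, G z ∂(Measure.infinitePi fun _ : ℕ => D) := by
  conv_rhs => rw [← map_update_infinitePi D t]
  rw [lintegral_map hG (measurable_update_pair t), lintegral_prod]
  exact (hG.comp (measurable_update_pair t)).aemeasurable

theorem infinitePi_preimage_perm (σ : Equiv.Perm ℕ) {A : Set (ℕ → X)} (hA : MeasurableSet A) :
    (Measure.infinitePi fun _ : ℕ => D) ((fun w k => w (σ k)) ⁻¹' A) =
      (Measure.infinitePi fun _ : ℕ => D) A := by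
  have h := Measure.map_infinitePi_infinitePi_of_inj (P := fun _ : ℕ => D) σ.injective
  rw [← Measure.map_apply (by fun_prop) hA, h]

end IID

/-! ## The fresh draws selected by an adversary, continued by a ghost sample -/

/-- The number of rounds before `t` without injection. -/
def freshCount (q : ℕ → Bool) : ℕ → ℕ
  | 0 => 0
  | t + 1 => if q t then freshCount q t else freshCount q t + 1

/-- The draws `z s` of the rounds `s < t` without injection, in their order, continued by the ghost
sample `z'`. -/
def mergedSample {X : Type*} (q : ℕ → Bool) (z z' : ℕ → X) : ℕ → ℕ → X
  | 0 => z'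
  | t + 1 => if q t then mergedSample q z z' t
      else Function.update (mergedSample q z z' t) (freshCount q t) (z t)

theorem freshCount_le (q : ℕ → Bool) (t : ℕ) : freshCount q t ≤ t := by
  induction t with
  | zero => rfl
  | succ t ih =>
    rw [freshCount]
    split_ifs <;> omega

theorem freshCount_congr {q q' : ℕ → Bool} {t : ℕ} (h : ∀ s < t, q s = q' s) :
    freshCount q t = freshCount q' t := by
  induction t with
  | zero => rfl
  | succ t ih => rw [freshCount, freshCount, ih fun s hs => h s (by omega), h t (by omega)]

section Merged

variable {X : Type*}

theorem mergedSample_congr {q q' : ℕ → Bool} {y z z' : ℕ → X} {t : ℕ}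
    (h : ∀ s < t, q s = q' s) (hz : ∀ s < t, y s = z s) :
    mergedSample q y z' t = mergedSample q' z z' t := by
  induction t with
  | zero => rfl
  | succ t ih =>
    rw [mergedSample, mergedSample, ih (fun s hs => h s (by omega)) fun s hs => hz s (by omega),
      h t (by omega), hz t (by omega), freshCount_congr fun s hs => h s (by omega)]

/-- Slots from `freshCount q t` on have not been overwritten and still hold ghost points. -/
theorem mergedSample_update_ghost (q : ℕ → Bool) (z z' : ℕ → X) {t m : ℕ} (x : X)
    (hm : freshCount q t ≤ m) :
    mergedSample q z (Function.update z' m x) t = Function.update (mergedSample q z z' t) m x := by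
  induction t with
  | zero => rfl
  | succ t ih =>
    rw [freshCount] at hm
    rw [mergedSample, mergedSample]
    split_ifs at hm ⊢ with h
    · exact ih hm
    · rw [ih (by omega), Function.update_comm (by omega)]

/-- Writing always happens at the current count, so a filled slot is frozen. -/
theorem mergedSample_eq_of_lt (q : ℕ → Bool) (z z' : ℕ → X) {t T k : ℕ} (htT : t ≤ T)
    (hk : k < freshCount q t) : mergedSample q z z' T k = mergedSample q z z' t k := by
  suffices h : mergedSample q z z' T k = mergedSample q z z' t k ∧ k < freshCount q T from h.1
  induction T, htT using Nat.le_induction with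
  | base => exact ⟨rfl, hk⟩
  | succ T _ ih =>
    rw [mergedSample, freshCount]
    split_ifs with h
    · exact ih
    · exact ⟨by rw [Function.update_of_ne (by omega), ih.1], by omega⟩

theorem mergedSample_freshCount (q : ℕ → Bool) (z z' : ℕ → X) {t T : ℕ} (htT : t < T)
    (hq : q t = false) : mergedSample q z z' T (freshCount q t) = z t := by
  rw [mergedSample_eq_of_lt q z z' (Nat.succ_le_of_lt htT) (by simp [freshCount, hq])]
  simp [mergedSample, hq]

variable [MeasurableSpace X]

theorem measurable_freshCount {Ω : Type*} [MeasurableSpace Ω] {q : Ω → ℕ → Bool}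
    (hq : ∀ t, Measurable fun ω => q ω t) (t : ℕ) : Measurable fun ω => freshCount (q ω) t := by
  induction t with
  | zero => exact measurable_const
  | succ t ih =>
    simp only [freshCount]
    exact Measurable.ite (hq t (measurableSet_singleton true)) ih (ih.add_const 1)

theorem measurable_mergedSample {Ω : Type*} [MeasurableSpace Ω] {q : Ω → ℕ → Bool}
    (hq : ∀ t, Measurable fun ω => q ω t) {z z' : Ω → ℕ → X} (hz : Measurable z)
    (hz' : Measurable z') (t : ℕ) :
    Measurable fun ω => mergedSample (q ω) (z ω) (z' ω) t := by
  induction t with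
  | zero => exact hz'
  | succ t ih =>
    refine measurable_pi_iff.2 fun k => ?_
    have h : ∀ ω, mergedSample (q ω) (z ω) (z' ω) (t + 1) k = if q ω t = true then
        mergedSample (q ω) (z ω) (z' ω) t k else if freshCount (q ω) t = k then z ω t else
          mergedSample (q ω) (z ω) (z' ω) t k := by
      intro ω
      rw [mergedSample]
      split_ifs with h1 h2
      · rfl
      · rw [← h2, Function.update_self]
      · rw [Function.update_of_ne (Ne.symm h2)]
    simp only [h]
    have hk := (measurable_pi_apply k).comp ih
    exact Measurable.ite (hq t (measurableSet_singleton true)) hk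
      (Measurable.ite (measurable_freshCount hq t (measurableSet_singleton k))
        ((measurable_pi_apply t).comp hz) hk)

/-- If round `t` is declared fresh without looking at the draws from `t` on, then the merged sample
is again i.i.d. -/
theorem lintegral_mergedSample (D : Measure X) [IsProbabilityMeasure D]
    {q : (ℕ → X) → ℕ → Bool} (hq : ∀ t, Measurable fun z => q z t)
    (hqu : ∀ z t s x, t ≤ s → q (Function.update z s x) t = q z t) (t : ℕ)
    {G : (ℕ → X) → ENNReal} (hG : Measurable G) :
    ∫⁻ z, ∫⁻ z', G (mergedSample (q z) z z' t) ∂(Measure.infinitePi fun _ : ℕ => D)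
      ∂(Measure.infinitePi fun _ : ℕ => D) = ∫⁻ z, G z ∂(Measure.infinitePi fun _ : ℕ => D) := by
  set P := Measure.infinitePi fun _ : ℕ => D
  have hmeas : ∀ t, Measurable fun p : (ℕ → X) × (ℕ → X) =>
      G (mergedSample (q p.1) p.1 p.2 t) := fun t =>
    hG.comp (measurable_mergedSample (fun s => (hq s).comp measurable_fst) measurable_fst
      measurable_snd t)
  induction t with
  | zero => simp [mergedSample]
  | succ t ih =>
    -- Resample draw `t` as a separate variable `x`; the decision, the count and the merged sample
    -- before round `t` do not depend on it.
    rw [← ih, ← lintegral_update_infinitePi D t (hmeas (t + 1)).lintegral_prod_right']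
    refine lintegral_congr fun z => ?_
    have hfc : ∀ x, freshCount (q (Function.update z t x)) t = freshCount (q z) t := fun x =>
      freshCount_congr fun s hs => hqu z s t x hs.le
    have hms : ∀ x z', mergedSample (q (Function.update z t x)) (Function.update z t x) z' t =
        mergedSample (q z) z z' t := fun x z' =>
      mergedSample_congr (fun s hs => hqu z s t x hs.le)
        fun s hs => Function.update_of_ne hs.ne _ _
    simp only [mergedSample, hqu z t t _ le_rfl, hfc, hms, Function.update_self]
    split_ifs with h
    · simp
    -- In a fresh round `x` replaces a ghost point, which amounts to resampling one coordinate of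
    -- the ghost sample.
    · have hz := hG.comp (measurable_mergedSample (q := fun _ : ℕ → X => q z) (z := fun _ => z)
        (fun s => measurable_const) measurable_const measurable_id t)
      have hr := lintegral_update_infinitePi D (freshCount (q z) t) hz
      simp only [Function.comp_apply, id_eq, mergedSample_update_ghost (q z) z _ _ le_rfl] at hr
      rw [← hr, lintegral_lintegral_swap]
      have h2 : Measurable fun p : X × (ℕ → X) => Function.update
          (mergedSample (q z) z p.2 t) (freshCount (q z) t) p.1 :=
        (measurable_update_pair (freshCount (q z) t)).comp
          (((measurable_mergedSample (q := fun _ : ℕ → X => q z) (z := fun _ => z)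
            (fun s => measurable_const) measurable_const measurable_id t).comp
              measurable_snd).prodMk measurable_fst)
      exact (hG.comp h2).aemeasurable

end Merged

/-! ## The probability of an outlying index -/

/-- Being outlying depends on the other points only as an unordered family; this is the symmetry
behind exchangeability. -/
theorem Outlying.of_perm {d : ℕ} {v : Fin d → ℝ≥0} {L n j : ℕ} {w : ℕ → Fin d → ℝ≥0}
    {σ : Equiv.Perm ℕ} (hσ : ∀ k, σ k ∈ Finset.range (n + 1) ↔ k ∈ Finset.range (n + 1))
    (h : Outlying v L n (fun k => w (σ k)) j) : Outlying v L n w (σ j) := by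
  obtain ⟨i, h⟩ := h
  refine ⟨i, h.imp (fun h => ⟨h.1, fun k hk hkj hk1 => ?_⟩)
    fun h => ⟨h.1, fun k hk hkj => ?_, fun J hJ hjJ hJi hinj => ?_⟩⟩
  · have := h.2 (σ.symm k) (by rwa [← hσ, σ.apply_symm_apply])
      (fun e => hkj (by rw [← e, σ.apply_symm_apply])) (by simpa using hk1)
    simpa using this
  · have := h.2.1 (σ.symm k) (by rwa [← hσ, σ.apply_symm_apply])
      (fun e => hkj (by rw [← e, σ.apply_symm_apply]))
    simpa using this
  · have := h.2.2 (J.map σ.symm.toEmbedding) ?_ ?_ ?_ ?_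
    · simpa using this
    · refine Finset.mem_powerset.2 fun k hk => ?_
      obtain ⟨l, hl, rfl⟩ := Finset.mem_map.1 hk
      rw [← hσ]
      simpa using Finset.mem_powerset.1 hJ hl
    · intro hj
      obtain ⟨l, hl, hlj⟩ := Finset.mem_map.1 hj
      exact hjJ (by rw [← hlj]; simpa using hl)
    · intro k hk
      obtain ⟨l, hl, rfl⟩ := Finset.mem_map.1 hk
      simpa using hJi l hl
    · intro k hk l hl hkl
      obtain ⟨k', hk', rfl⟩ := Finset.mem_map.1 hk
      obtain ⟨l', hl', rfl⟩ := Finset.mem_map.1 hl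
      rw [hinj k' hk' l' hl' (by simpa using hkl)]

theorem measurable_rectConcept_eq_one {d : ℕ} (v : Fin d → ℝ≥0) {Ω : Type*} [MeasurableSpace Ω]
    {x : Ω → Fin d → ℝ≥0} (hx : Measurable x) :
    MeasurableSet {ω | rectConcept v (x ω) = 1} := by
  simp only [rectConcept_eq_one_iff]
  measurability

theorem measurableSet_outlying {d : ℕ} (v : Fin d → ℝ≥0) (L n j : ℕ) :
    MeasurableSet {w | Outlying v L n w j} := by
  have h1 : ∀ k, Measurable fun w : ℕ → Fin d → ℝ≥0 => rectConcept v (w k) = 1 := fun k =>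
    measurableSet_setOfPred.1 (measurable_rectConcept_eq_one v (measurable_pi_apply k))
  have h2 : ∀ k l, ∀ i : Fin d, Measurable fun w : ℕ → Fin d → ℝ≥0 => w k i < w l i :=
    fun k l i => measurableSet_setOfPred.1 (measurableSet_lt (by fun_prop) (by fun_prop))
  have h3 : ∀ k l, ∀ i : Fin d, Measurable fun w : ℕ → Fin d → ℝ≥0 => w k i ≤ w l i :=
    fun k l i => measurableSet_setOfPred.1 (measurableSet_le (by fun_prop) (by fun_prop))
  have h4 : ∀ k, ∀ i : Fin d, Measurable fun w : ℕ → Fin d → ℝ≥0 => v i < w k i :=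
    fun k i => measurableSet_setOfPred.1 (measurableSet_lt (by fun_prop) (by fun_prop))
  have h5 : ∀ k l, Measurable fun w : ℕ → Fin d → ℝ≥0 => w k = w l := fun k l =>
    measurableSet_setOfPred.1 (measurableSet_eq_fun (by fun_prop) (by fun_prop))
  refine measurableSet_setOfPred.2 ?_
  unfold Outlying PositivePeak ShallowNegative
  refine Measurable.exists fun i => Measurable.or ?_ ?_
  · refine (h1 j).and (Measurable.forall fun k => measurable_const.imp
      (measurable_const.imp ((h1 k).imp (h2 k j i))))
  · refine (h4 j i).and (Measurable.and (Measurable.forall fun k => measurable_const.imp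
      (measurable_const.imp (h5 k j).not)) ?_)
    refine Measurable.forall fun J => measurable_const.imp (measurable_const.imp
      (Measurable.imp ?_ (Measurable.imp ?_ measurable_const)))
    · exact Measurable.forall fun k => measurable_const.imp ((h4 k i).and (h3 k j i))
    · exact Measurable.forall fun k => measurable_const.imp
        (Measurable.forall fun l => measurable_const.imp ((h5 k l).imp measurable_const))

/-- Swapping `n` with `j` shows that index `j ≤ n` is at least as likely to be outlying as `n`. The
sum over `j` is the expected number of outlying indices, bounded pointwise by `card_outlying_le`. -/
theorem prob_outlying_le {d : ℕ} (D : Measure (Fin d → ℝ≥0)) [IsProbabilityMeasure D]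
    (v : Fin d → ℝ≥0) (L n : ℕ) :
    ((n + 1 : ℕ) : ENNReal) * (Measure.infinitePi fun _ : ℕ => D) {w | Outlying v L n w n} ≤
      ((d * (L + 2) : ℕ) : ENNReal) := by
  classical
  set P := Measure.infinitePi fun _ : ℕ => D
  have h1 : ∀ j ∈ Finset.range (n + 1),
      P {w | Outlying v L n w n} ≤ P {w | Outlying v L n w j} := by
    intro j hj
    rw [← infinitePi_preimage_perm D (Equiv.swap n j) (measurableSet_outlying v L n n)]
    refine measure_mono fun w hw => ?_
    have := Outlying.of_perm (fun k => ?_) hw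
    · rwa [Equiv.swap_apply_left] at this
    · have hn : n ∈ Finset.range (n + 1) := by simp
      rcases eq_or_ne k n with rfl | h1
      · simp [hn, hj]
      rcases eq_or_ne k j with rfl | h2
      · simp [hn, hj]
      rw [Equiv.swap_apply_of_ne_of_ne h1 h2]
  calc ((n + 1 : ℕ) : ENNReal) * P {w | Outlying v L n w n}
      = ∑ j ∈ Finset.range (n + 1), P {w | Outlying v L n w n} := by simp
    _ ≤ ∑ j ∈ Finset.range (n + 1), P {w | Outlying v L n w j} := Finset.sum_le_sum h1
    _ = ∫⁻ w, ∑ j ∈ Finset.range (n + 1), {w | Outlying v L n w j}.indicator 1 w ∂P := by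
        rw [lintegral_finsetSum _ fun j _ =>
          measurable_one.indicator (measurableSet_outlying v L n j)]
        exact Finset.sum_congr rfl fun j _ =>
          (lintegral_indicator_one (measurableSet_outlying v L n j)).symm
    _ ≤ ∫⁻ w, ((d * (L + 2) : ℕ) : ENNReal) ∂P := by
        refine lintegral_mono fun w => ?_
        refine le_trans (le_of_eq ?_) (Nat.cast_le.2 (card_outlying_le v L n w))
        rw [Finset.card_filter, Nat.cast_sum]
        refine Finset.sum_congr rfl fun j _ => ?_
        simp [Set.indicator_apply]
    _ = _ := by simp

/-! ## Measurability of the learner and of the transcript -/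

instance Int.units_discreteMeasurableSpace : DiscreteMeasurableSpace ℤˣ where
  forall_measurableSet s :=
    ⟨Units.val '' s, trivial, Set.preimage_image_eq s Units.val_injective⟩

/-- For measurability, histories are handled as ranges of finite tuples, possibly with repetitions.
-/
theorem versionSpace_range_nonempty_iff {d : ℕ} {ι : Type*} [Fintype ι]
    (w : ι → (Fin d → ℝ≥0) × ℤˣ) :
    (versionSpace (rectangles d) (Set.range w)).Nonempty ↔
      ∀ k, (w k).2 = -1 → ∃ i, 0 < (w k).1 i ∧ ∀ l, (w l).2 = 1 → (w l).1 i < (w k).1 i := by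
  classical
  have h := versionSpace_rectangles_nonempty_iff (Finset.univ.image w)
  rw [Finset.coe_image, Finset.coe_univ, Set.image_univ] at h
  rw [h]
  simp only [Finset.mem_image, Finset.mem_univ, true_and, forall_exists_index,
    forall_apply_eq_imp_iff]

theorem range_option_elim {α ι : Type*} (a : α) (w : ι → α) :
    Set.range (fun o : Option ι => o.elim a w) = insert a (Set.range w) := by
  ext b
  simp [Option.exists, eq_comm]

theorem measurable_option_elim {Ω ι α : Type*} [MeasurableSpace Ω] [MeasurableSpace α] {a : Ω → α} {W : Ω → ι → α}
    (ha : Measurable a) (hW : Measurable W) :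
    Measurable fun ω => fun o : Option ι => o.elim (a ω) (W ω) := by
  refine measurable_pi_iff.2 fun o => ?_
  cases o with
  | none => exact ha
  | some k => exact (measurable_pi_apply k).comp hW

section Measurability

variable {Ω : Type*} [MeasurableSpace Ω] {d : ℕ} {ι : Type*} [Fintype ι]

theorem measurable_versionSpace_nonempty {W : Ω → ι → (Fin d → ℝ≥0) × ℤˣ} (hW : Measurable W) :
    Measurable fun ω => (versionSpace (rectangles d) (Set.range (W ω))).Nonempty := by
  simp only [versionSpace_range_nonempty_iff]
  have hlab : ∀ k y, Measurable fun ω => (W ω k).2 = y := fun k y =>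
    measurableSet_setOfPred.1
      ((measurable_snd.comp ((measurable_pi_apply k).comp hW)) (measurableSet_singleton y))
  have hpt : ∀ k i, Measurable fun ω => (W ω k).1 i := fun k i =>
    (measurable_pi_apply i).comp (measurable_fst.comp ((measurable_pi_apply k).comp hW))
  refine Measurable.forall fun k => (hlab k _).imp (Measurable.exists fun i => Measurable.and ?_
    (Measurable.forall fun l => (hlab l _).imp ?_))
  · exact measurableSet_setOfPred.1 (measurableSet_lt measurable_const (hpt k i))
  · exact measurableSet_setOfPred.1 (measurableSet_lt (hpt l i) (hpt k i))

theorem measurable_versionSpace_insert_nonempty {W : Ω → ι → (Fin d → ℝ≥0) × ℤˣ}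
    (hW : Measurable W) {z : Ω → (Fin d → ℝ≥0) × ℤˣ} (hz : Measurable z) :
    Measurable fun ω =>
      (versionSpace (rectangles d) (insert (z ω) (Set.range (W ω)))).Nonempty := by
  simp only [← range_option_elim]
  exact measurable_versionSpace_nonempty (measurable_option_elim hz hW)

theorem measurable_cutCount {W : Ω → ι → (Fin d → ℝ≥0) × ℤˣ}
    (hW : Measurable W) {x : Ω → Fin d → ℝ≥0} (hx : Measurable x) :
    Measurable fun ω => cutCount (Set.range (W ω)) (x ω) := by
  classical
  have h : ∀ ω, cutCount (Set.range (W ω)) (x ω) = ∑ i : Fin d,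
      if (versionSpace (rectangles d)
        (insert (Pi.single i (x ω i), -1) (Set.range (W ω)))).Nonempty then 1 else 0 := by
    intro ω
    unfold cutCount
    rw [Set.ncard_eq_toFinset_card', Set.toFinset_ofPred, Finset.card_filter]
  simp only [h]
  refine Finset.measurable_sum _ fun i _ => Measurable.ite (measurableSet_setOfPred.2
    (measurable_versionSpace_insert_nonempty hW (Measurable.prodMk ?_ measurable_const)))
    measurable_const measurable_const
  refine measurable_pi_iff.2 fun j => ?_
  by_cases hj : j = i
  · subst hj
    simp only [Pi.single_eq_same]
    fun_prop
  · simp only [Pi.single_eq_of_ne hj]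
    fun_prop

/-- The sum over distinct examples is rewritten as a sum over indices in which each term is divided
by the multiplicity of its example. -/
theorem measurable_potential {W : Ω → ι → (Fin d → ℝ≥0) × ℤˣ} (hW : Measurable W)
    {S : Ω → Finset ((Fin d → ℝ≥0) × ℤˣ)}
    (hS : ∀ ω, (S ω : Set ((Fin d → ℝ≥0) × ℤˣ)) = Set.range (W ω)) :
    Measurable fun ω => potential (rectangles d) 1 (rectScore d) (S ω) := by
  classical
  have hk : ∀ k, Measurable fun ω => W ω k := fun k => (measurable_pi_apply k).comp hW
  have heq : ∀ k l, MeasurableSet {ω | W ω l = W ω k} := fun k l => by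
    simp only [Prod.ext_iff]
    exact (measurableSet_eq_fun (hk l).fst (hk k).fst).inter
      (measurableSet_eq_fun (hk l).snd (hk k).snd)
  have h : ∀ ω, potential (rectangles d) 1 (rectScore d) (S ω) = ∑ k,
      (cutCount (Set.range (W ω)) (W ω k).1 : ℝ) /
        ((∑ l, if W ω l = W ω k then 1 else 0 : ℕ) : ℝ) := by
    intro ω
    have hS' : S ω = Finset.univ.image (W ω) := by
      apply Finset.coe_injective
      rw [hS, Finset.coe_image, Finset.coe_univ, Set.image_univ]
    rw [potential_rectScore, hS ω, hS']
    refine Finset.sum_image' _ fun k _ => ?_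
    have hc : ∀ j ∈ Finset.univ.filter fun j => W ω j = W ω k,
        (cutCount (Set.range (W ω)) (W ω j).1 : ℝ) /
          ((∑ l, if W ω l = W ω j then 1 else 0 : ℕ) : ℝ) =
        (cutCount (Set.range (W ω)) (W ω k).1 : ℝ) /
          ((∑ l, if W ω l = W ω k then 1 else 0 : ℕ) : ℝ) := by
      intro j hj
      rw [(Finset.mem_filter.1 hj).2]
    rw [Finset.sum_congr rfl hc, Finset.sum_const, ← Finset.card_filter, nsmul_eq_mul,
      mul_div_cancel₀]
    exact Nat.cast_ne_zero.2 (Finset.card_pos.2 ⟨k, by simp⟩).ne'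
  simp only [h]
  refine Finset.measurable_sum _ fun k _ => Measurable.div ?_ ?_
  · exact measurable_from_nat.comp (measurable_cutCount hW (hk k).fst)
  · exact measurable_from_nat.comp (Finset.measurable_sum _ fun l _ =>
      Measurable.ite (heq k l) measurable_const measurable_const)

theorem measurable_potentialDrop {W : Ω → ι → (Fin d → ℝ≥0) × ℤˣ} (hW : Measurable W)
    {S : Ω → Finset ((Fin d → ℝ≥0) × ℤˣ)}
    (hS : ∀ ω, (S ω : Set ((Fin d → ℝ≥0) × ℤˣ)) = Set.range (W ω))
    {x : Ω → Fin d → ℝ≥0} (hx : Measurable x) (b : ℤˣ) :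
    Measurable fun ω => potentialDrop (rectangles d) 1 (rectScore d) (S ω) (x ω) b := by
  unfold potentialDrop
  refine (measurable_potential hW hS).sub (measurable_potential
    (measurable_option_elim (hx.prodMk (measurable_const (a := b))) hW) fun ω => ?_)
  rw [range_option_elim, ← hS]
  convert Finset.coe_insert (x ω, b) (S ω)

theorem measurable_potentialLearner {W : Ω → ι → (Fin d → ℝ≥0) × ℤˣ} (hW : Measurable W)
    {S : Ω → Finset ((Fin d → ℝ≥0) × ℤˣ)}
    (hS : ∀ ω, (S ω : Set ((Fin d → ℝ≥0) × ℤˣ)) = Set.range (W ω))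
    {x : Ω → Fin d → ℝ≥0} (hx : Measurable x) (α : ℝ) (tie : ℤˣ) :
    Measurable[_, ⊤] fun ω =>
      potentialLearner (rectangles d) 1 (rectScore d) α tie (S ω) (x ω) := by
  classical
  have hne : ∀ b : ℤˣ, MeasurableSet
      {ω | restrictTo (versionSpace (rectangles d) (S ω : Set _)) (x ω) b = ∅} := fun b => by
    simp only [restrictTo_versionSpace, hS, ← Set.not_nonempty_iff_eq_empty]
    exact (measurableSet_setOfPred.2 (measurable_versionSpace_insert_nonempty hW
      (hx.prodMk measurable_const))).compl
  have hd := measurable_potentialDrop hW hS hx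
  let _ : MeasurableSpace (Option ℤˣ) := ⊤
  unfold potentialLearner
  refine Measurable.ite (hne 1) measurable_const (Measurable.ite (hne (-1)) measurable_const
    (Measurable.ite (measurableSet_le measurable_const ((hd 1).max (hd (-1)))) ?_
      measurable_const))
  have h2 : Measurable fun b : ℤˣ => some (-b) := fun _ _ => MeasurableSet.of_discrete
  exact h2.comp (Measurable.ite (measurableSet_lt (hd tie) (hd (-tie))) measurable_const
    measurable_const)

end Measurability

section Rounds

variable {X : Type*} [MeasurableSpace X]

theorem measurable_round {Ω : Type*} [MeasurableSpace Ω] {f : Ω → Round X}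
    (h1 : Measurable fun ω => (f ω).inst) (h2 : Measurable fun ω => (f ω).injected)
    (h3 : Measurable[_, ⊤] fun ω => (f ω).pred) (h4 : Measurable fun ω => (f ω).label) :
    Measurable f := by
  rw [measurable_iff_comap_le]
  change MeasurableSpace.comap f (_ ⊔ _) ≤ _
  rw [MeasurableSpace.comap_sup, sup_le_iff, MeasurableSpace.comap_comp, MeasurableSpace.comap_comp,
    ← measurable_iff_comap_le, ← measurable_iff_comap_le]
  refine ⟨h1, ?_⟩
  let _ : MeasurableSpace (Bool × Option ℤˣ × ℤˣ) := ⊤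
  refine measurable_to_countable' fun y => ?_
  have : (fun ρ : Round X => (ρ.injected, ρ.pred, ρ.label)) ∘ f ⁻¹' {y} =
      ((fun ω => (f ω).injected) ⁻¹' {y.1} ∩ (fun ω => (f ω).pred) ⁻¹' {y.2.1}) ∩
        (fun ω => (f ω).label) ⁻¹' {y.2.2} := by
    ext ω
    simp [Prod.ext_iff, and_assoc]
  rw [this]
  exact ((h2 (measurableSet_singleton _)).inter (h3 trivial)).inter (h4 (measurableSet_singleton _))

theorem Round.measurable_inst : Measurable (Round.inst : Round X → X) := by
  rw [measurable_iff_comap_le]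
  exact le_sup_left

theorem Round.measurable_of_components {β : Type*} [MeasurableSpace β]
    (g : Bool × Option ℤˣ × ℤˣ → β) :
    Measurable fun ρ : Round X => g (ρ.injected, ρ.pred, ρ.label) := by
  have h : Measurable[_, ⊤] fun ρ : Round X => (ρ.injected, ρ.pred, ρ.label) := by
    rw [measurable_iff_comap_le]
    exact le_sup_right
  exact (measurable_from_top (f := g)).comp h

end Rounds

theorem measurable_transcript {d : ℕ} {R : Type*} [MeasurableSpace R]
    {target : (Fin d → ℝ≥0) → ℤˣ} (ht : target ∈ rectangles d) (α : ℝ) (tie : ℤˣ)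
    (adv : Adversary R (Fin d → ℝ≥0)) (t : ℕ) :
    Measurable fun ω : R × (ℕ → Fin d → ℝ≥0) => transcript
      (potentialLearner (rectangles d) 1 (rectScore d) α tie) target adv ω.1 ω.2 t := by
  classical
  have htm : Measurable target := by
    obtain ⟨v, rfl⟩ := ht
    unfold rectConcept
    refine Measurable.ite ?_ measurable_const measurable_const
    measurability
  induction t with
  | zero => exact measurable_pi_iff.2 fun i => i.elim0
  | succ t ih =>
    have hq := (adv.measurable_inject t).comp (measurable_fst.prodMk ih)
    have hp := (adv.measurable_point t).comp (measurable_fst.prodMk ih)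
    have hx : Measurable fun ω : R × (ℕ → Fin d → ℝ≥0) => (playRound
        (potentialLearner (rectangles d) 1 (rectScore d) α tie) target adv ω.1 t (transcript
        (potentialLearner (rectangles d) 1 (rectScore d) α tie) target adv ω.1 ω.2 t)
        (ω.2 t)).inst :=
      Measurable.ite (hq (measurableSet_singleton true)) hp
        ((measurable_pi_apply t).comp measurable_snd)
    refine measurable_pi_iff.2 fun i => ?_
    simp only [transcript]
    refine Fin.lastCases ?_ (fun j => ?_) i
    · simp only [Fin.snoc_last]
      refine measurable_round hx hq ?_ (htm.comp hx)
      refine measurable_potentialLearner (ι := Fin t) (W := fun ω s =>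
        ((transcript (potentialLearner (rectangles d) 1 (rectScore d) α tie) target adv
          ω.1 ω.2 t s).inst, (transcript (potentialLearner (rectangles d) 1 (rectScore d) α tie)
            target adv ω.1 ω.2 t s).label)) ?_ ?_ hx α tie
      · refine measurable_pi_iff.2 fun s => ?_
        have hs := (measurable_pi_apply s).comp ih
        exact (Round.measurable_inst.comp hs).prodMk
          ((Round.measurable_of_components fun p => p.2.2).comp hs)
      · intro ω
        simp [samples]
    · simp only [Fin.snoc_castSucc]
      exact (measurable_pi_apply j).comp ih

theorem measurable_errMis {X : Type*} [MeasurableSpace X] (T : ℕ) :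
    Measurable fun H : Fin T → Round X => errMis H := by
  unfold errMis
  simp only [Finset.card_filter]
  exact Finset.measurable_sum _ fun t _ => (Round.measurable_of_components (X := X)
    fun p => if p.2.1 ≠ some p.2.2 ∧ p.2.1 ≠ none then 1 else 0).comp (measurable_pi_apply t)

theorem measurable_errAbs {X : Type*} [MeasurableSpace X] (T : ℕ) :
    Measurable fun H : Fin T → Round X => errAbs H := by
  unfold errAbs
  simp only [Finset.card_filter]
  exact Finset.measurable_sum _ fun t _ => (Round.measurable_of_components (X := X)
    fun p => if p.2.1 = none ∧ p.1 = false then 1 else 0).comp (measurable_pi_apply t)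

/-! ## Counting wrong abstentions -/

/-- Whether the adversary injects in round `t`. -/
noncomputable def injects {R X : Type*} [MeasurableSpace R] [MeasurableSpace X]
    (learner : Finset (X × ℤˣ) → X → Option ℤˣ) (target : X → ℤˣ) (adv : Adversary R X)
    (r : R) (z : ℕ → X) (t : ℕ) : Bool :=
  adv.inject t r (transcript learner target adv r z t)

section

variable {R X : Type*} [MeasurableSpace R] [MeasurableSpace X]
  {learner : Finset (X × ℤˣ) → X → Option ℤˣ} {target : X → ℤˣ} {adv : Adversary R X}
  {r : R} {z : ℕ → X}

theorem mergedSample_mem_samples (z' : ℕ → X) {t k : ℕ}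
    (hk : k < freshCount (injects learner target adv r z) t) :
    (mergedSample (injects learner target adv r z) z z' t k,
      target (mergedSample (injects learner target adv r z) z z' t k)) ∈
      samples (transcript learner target adv r z t) := by
  classical
  induction t with
  | zero => simp [freshCount] at hk
  | succ t ih =>
    rw [transcript, samples_snoc, Finset.mem_insert]
    rw [freshCount] at hk
    rw [mergedSample]
    split_ifs at hk ⊢ with hq
    · exact Or.inr (ih hk)
    · rcases eq_or_ne k (freshCount (injects learner target adv r z) t) with rfl | hne
      · left
        rw [Function.update_self]
        have : adv.inject t r (transcript learner target adv r z t) = false := by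
          simpa [injects] using hq
        simp [playRound, this]
      · rw [Function.update_of_ne hne]
        exact Or.inr (ih (by omega))

end

open Classical in
-- A fresh round fills slot `n` of the merged sample, and all earlier slots are in the history; an
-- abstention there makes `n` outlying. Different fresh rounds fill different slots.
theorem errAbs_le_card_outlying {d : ℕ} {R : Type*} [MeasurableSpace R] {v : Fin d → ℝ≥0}
    {α : ℝ} {tie : ℤˣ} {L : ℕ} (hL : α + d ≤ L + 1) (adv : Adversary R (Fin d → ℝ≥0)) (r : R)
    (z z' : ℕ → Fin d → ℝ≥0) (T : ℕ) :
    errAbs (transcript (potentialLearner (rectangles d) 1 (rectScore d) α tie) (rectConcept v)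
      adv r z T) ≤
    ((Finset.range T).filter fun n => Outlying v L n (mergedSample (injects (potentialLearner
      (rectangles d) 1 (rectScore d) α tie) (rectConcept v) adv r z) z z' T) n).card := by
  generalize hlearn : potentialLearner (rectangles d) 1 (rectScore d) α tie = learner
  set q := injects learner (rectConcept v) adv r z with hq
  -- The merged sample stays at horizon `T` during the induction, which is harmless because filled
  -- slots are frozen.
  have key : ∀ t ≤ T, errAbs (transcript learner (rectConcept v) adv r z t) ≤
      ((Finset.range (freshCount q t)).filter fun n =>
        Outlying v L n (mergedSample q z z' T) n).card := by
    intro t htT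
    induction t with
    | zero => simp [errAbs]
    | succ t ih =>
      have ih := ih (by omega)
      rw [transcript, errAbs_snoc, freshCount]
      by_cases hqt : q t = true
      · have hinj : adv.inject t r (transcript learner (rectConcept v) adv r z t) = true := hqt
        simpa [playRound, hinj, hqt] using ih
      · have hqf : q t = false := by simpa using hqt
        have hinj : adv.inject t r (transcript learner (rectConcept v) adv r z t) = false := hqf
        rw [if_neg hqt, Finset.range_add_one, Finset.filter_insert]
        simp only [playRound, hinj]
        have hout : learner (samples (transcript learner (rectConcept v) adv r z t)) (z t) = none →
            Outlying v L (freshCount q t) (mergedSample q z z' T) (freshCount q t) := by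
          intro h
          subst hlearn
          rw [← mergedSample_freshCount q z z' (Nat.lt_of_succ_le htT) hqf] at h
          refine outlying_of_abstention hL label_of_mem_samples_transcript (fun k hk => ?_) h
          rw [mergedSample_eq_of_lt q z z' (by omega) hk]
          exact mergedSample_mem_samples z' hk
        by_cases h : learner (samples (transcript learner (rectConcept v) adv r z t)) (z t) = none
        · rw [if_pos (hout h), Finset.card_insert_of_notMem (by simp)]
          simpa [h] using ih
        · have : (if Outlying v L (freshCount q t) (mergedSample q z z' T) (freshCount q t) then
              insert (freshCount q t) ((Finset.range (freshCount q t)).filter fun n =>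
                Outlying v L n (mergedSample q z z' T) n) else
              (Finset.range (freshCount q t)).filter fun n =>
                Outlying v L n (mergedSample q z z' T) n).card ≥
              ((Finset.range (freshCount q t)).filter fun n =>
                Outlying v L n (mergedSample q z z' T) n).card := by
            split_ifs
            · exact Finset.card_le_card (Finset.subset_insert _ _)
            · exact le_rfl
          simpa [h] using ih.trans this
  refine (key T le_rfl).trans (Finset.card_le_card (Finset.filter_subset_filter _ ?_))
  exact Finset.range_subset_range.2 (freshCount_le q T)

theorem lintegral_errAbs_le {d : ℕ} {R : Type*} [MeasurableSpace R] (ν : Measure R)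
    [IsProbabilityMeasure ν] (D : Measure (Fin d → ℝ≥0)) [IsProbabilityMeasure D]
    {v : Fin d → ℝ≥0} {α : ℝ} {tie : ℤˣ} {L : ℕ} (hL : α + d ≤ L + 1)
    (adv : Adversary R (Fin d → ℝ≥0)) (T : ℕ) :
    ∫⁻ ω, (errAbs (transcript (potentialLearner (rectangles d) 1 (rectScore d) α tie)
      (rectConcept v) adv ω.1 ω.2 T) : ENNReal) ∂(injectionLaw ν D) ≤
    ∑ n ∈ Finset.range T, ((d * (L + 2) : ℕ) : ENNReal) / ((n + 1 : ℕ) : ENNReal) := by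
  classical
  have htr := fun t => measurable_transcript (d := d) (R := R) ⟨v, rfl⟩ α tie adv t
  generalize hlearn : potentialLearner (rectangles d) 1 (rectScore d) α tie = learner at htr ⊢
  have hmeas : Measurable fun ω : R × (ℕ → Fin d → ℝ≥0) =>
      (errAbs (transcript learner (rectConcept v) adv ω.1 ω.2 T) : ENNReal) :=
    (measurable_from_nat (f := fun n : ℕ => (n : ENNReal))).comp ((measurable_errAbs T).comp (htr T))
  set P := Measure.infinitePi fun _ : ℕ => D with hP
  rw [injectionLaw, lintegral_prod _ hmeas.aemeasurable]
  set c := ∑ n ∈ Finset.range T, ((d * (L + 2) : ℕ) : ENNReal) / ((n + 1 : ℕ) : ENNReal)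
  have hG : Measurable fun w : ℕ → Fin d → ℝ≥0 =>
      ∑ n ∈ Finset.range T, {w | Outlying v L n w n}.indicator (1 : (ℕ → Fin d → ℝ≥0) → ENNReal) w :=
    Finset.measurable_sum _ fun n _ => measurable_one.indicator (measurableSet_outlying v L n n)
  -- The bound holds for each fixed seed, so the adversary may be treated as deterministic.
  suffices h : ∀ r, ∫⁻ z, (errAbs (transcript learner (rectConcept v) adv r z T) : ENNReal) ∂P
      ≤ c by
    calc _ ≤ ∫⁻ _, c ∂ν := lintegral_mono h
      _ = c := by simp
  intro r
  calc ∫⁻ z, (errAbs (transcript learner (rectConcept v) adv r z T) : ENNReal) ∂P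
      = ∫⁻ z, ∫⁻ _, (errAbs (transcript learner (rectConcept v) adv r z T) : ENNReal) ∂P ∂P := by
        simp
    _ ≤ ∫⁻ z, ∫⁻ z', (∑ n ∈ Finset.range T, {w | Outlying v L n w n}.indicator (1 : (ℕ → Fin d → ℝ≥0) → ENNReal)
          (mergedSample (injects learner (rectConcept v) adv r z) z z' T)) ∂P ∂P := by
        refine lintegral_mono fun z => lintegral_mono fun z' => ?_
        subst hlearn
        refine (Nat.cast_le.2 (errAbs_le_card_outlying hL adv r z z' T)).trans (le_of_eq ?_)
        rw [Finset.card_filter, Nat.cast_sum]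
        refine Finset.sum_congr rfl fun j _ => ?_
        simp [Set.indicator_apply]
    _ = ∫⁻ w, ∑ n ∈ Finset.range T, {w | Outlying v L n w n}.indicator (1 : (ℕ → Fin d → ℝ≥0) → ENNReal) w ∂P := by
        refine lintegral_mergedSample D (fun t => ?_) (fun z t s x hts => ?_) T hG
        · exact (adv.measurable_inject t).comp (measurable_const.prodMk
            ((htr t).comp (measurable_const.prodMk measurable_id)))
        · simp only [injects]
          rw [transcript_update hts]
    _ = ∑ n ∈ Finset.range T, P {w | Outlying v L n w n} := by
        rw [lintegral_finsetSum _ fun n _ =>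
          measurable_one.indicator (measurableSet_outlying v L n n)]
        exact Finset.sum_congr rfl fun n _ =>
          lintegral_indicator_one (measurableSet_outlying v L n n)
    _ ≤ c := by
        refine Finset.sum_le_sum fun n _ => ?_
        rw [ENNReal.le_div_iff_mul_le (by simp) (by simp), mul_comm]
        exact prob_outlying_le D v L n

theorem sum_div_le_one_add_log (B T : ℕ) :
    ∑ n ∈ Finset.range T, ((B : ENNReal) / ((n + 1 : ℕ) : ENNReal)) ≤
      ENNReal.ofReal (B * (1 + Real.log T)) := by
  have h : ∀ n ∈ Finset.range T, (B : ENNReal) / ((n + 1 : ℕ) : ENNReal) =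
      ENNReal.ofReal (B * ((n : ℝ) + 1)⁻¹) := by
    intro n _
    rw [← div_eq_mul_inv, ENNReal.ofReal_div_of_pos (by positivity), ENNReal.ofReal_natCast]
    congr 1
    rw [← Nat.cast_succ, ENNReal.ofReal_natCast]
  rw [Finset.sum_congr rfl h, ← ENNReal.ofReal_sum_of_nonneg fun n _ => by positivity]
  refine ENNReal.ofReal_le_ofReal ?_
  rw [← Finset.mul_sum]
  refine mul_le_mul_of_nonneg_left ?_ (by positivity)
  have := harmonic_le_one_add_log T
  simpa [harmonic] using this

/-- The expected number of wrong abstentions. -/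
theorem integral_errAbs_le {d : ℕ} {R : Type*} [MeasurableSpace R] (ν : Measure R)
    [IsProbabilityMeasure ν] (D : Measure (Fin d → ℝ≥0)) [IsProbabilityMeasure D]
    {target : (Fin d → ℝ≥0) → ℤˣ} (ht : target ∈ rectangles d) {α : ℝ} {tie : ℤˣ} {L : ℕ}
    (hL : α + d ≤ L + 1) (adv : Adversary R (Fin d → ℝ≥0)) (T : ℕ) :
    ∫ ω, (errAbs (transcript (potentialLearner (rectangles d) 1 (rectScore d) α tie)
      target adv ω.1 ω.2 T) : ℝ) ∂(injectionLaw ν D) ≤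
    d * (L + 2) * (1 + Real.log T) := by
  have hmeas : Measurable fun ω : R × (ℕ → Fin d → ℝ≥0) => (errAbs (transcript
      (potentialLearner (rectangles d) 1 (rectScore d) α tie) target adv ω.1 ω.2 T) : ℝ) :=
    (measurable_from_nat (f := fun n : ℕ => (n : ℝ))).comp
      ((measurable_errAbs T).comp (measurable_transcript ht α tie adv T))
  obtain ⟨v, rfl⟩ := ht
  rw [integral_eq_lintegral_of_nonneg_ae (Filter.Eventually.of_forall fun _ => by positivity)
    hmeas.aestronglyMeasurable]
  have hlog : 0 ≤ Real.log T := Real.log_natCast_nonneg T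
  refine ENNReal.toReal_le_of_le_ofReal (by positivity) ?_
  simp only [ENNReal.ofReal_natCast]
  refine (lintegral_errAbs_le ν D hL adv T).trans ((sum_div_le_one_add_log _ T).trans ?_)
  push_cast
  exact le_rfl

/-! ### Combining mistakes and abstentions -/

theorem integrable_errMis_errAbs {d : ℕ} {R : Type*} [MeasurableSpace R] (ν : Measure R)
    [IsProbabilityMeasure ν] (D : Measure (Fin d → ℝ≥0)) [IsProbabilityMeasure D]
    {target : (Fin d → ℝ≥0) → ℤˣ} (ht : target ∈ rectangles d) (α : ℝ) (tie : ℤˣ)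
    (adv : Adversary R (Fin d → ℝ≥0)) (T : ℕ) :
    Integrable (fun ω => (errMis (transcript (potentialLearner (rectangles d) 1 (rectScore d) α tie)
        target adv ω.1 ω.2 T) : ℝ)) (injectionLaw ν D) ∧
      Integrable (fun ω => (errAbs (transcript (potentialLearner (rectangles d) 1 (rectScore d) α
        tie) target adv ω.1 ω.2 T) : ℝ)) (injectionLaw ν D) := by
  have : IsProbabilityMeasure (injectionLaw ν D) := by
    unfold injectionLaw
    infer_instance
  have htr := measurable_transcript (R := R) ht α tie adv T
  have hcast : Measurable fun n : ℕ => (n : ℝ) := measurable_from_nat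
  constructor
  · refine Integrable.of_bound
      (hcast.comp ((measurable_errMis T).comp htr)).aestronglyMeasurable T
      (Filter.Eventually.of_forall fun ω => ?_)
    have := errMis_add_errAbs_le (transcript (potentialLearner (rectangles d) 1 (rectScore d) α tie)
        target adv ω.1 ω.2 T)
    rw [Real.norm_natCast]
    exact Nat.cast_le.2 (by omega)
  · refine Integrable.of_bound
      (hcast.comp ((measurable_errAbs T).comp htr)).aestronglyMeasurable T
      (Filter.Eventually.of_forall fun ω => ?_)
    have := errMis_add_errAbs_le (transcript (potentialLearner (rectangles d) 1 (rectScore d) α tie)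
        target adv ω.1 ω.2 T)
    rw [Real.norm_natCast]
    exact Nat.cast_le.2 (by omega)

theorem lemma4p6 :
    (∀ d : ℕ, 1 ≤ d → IsGood (rectangles d) (rectScore d) (2 * d + 1) (d : ℝ) 1) ∧
    ∃ (K : ℝ) (p : ℕ), 0 < K ∧
      ∀ (d T : ℕ), 1 ≤ d → 1 ≤ T →
        ∃ α : ℝ, 0 < α ∧
          ∀ (tie : ℤˣ) (target : (Fin d → ℝ≥0) → ℤˣ), target ∈ rectangles d →
          ∀ (D : Measure (Fin d → ℝ≥0)) [IsProbabilityMeasure D]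
            (R : Type*) [MeasurableSpace R] (ν : Measure R) [IsProbabilityMeasure ν]
            (adv : Adversary R (Fin d → ℝ≥0)),
            Integrable
              (combinedError (potentialLearner (rectangles d) 1 (rectScore d) α tie) target adv T)
              (injectionLaw ν D) ∧
            ∫ ω, combinedError (potentialLearner (rectangles d) 1 (rectScore d) α tie)
                target adv T ω ∂(injectionLaw ν D) ≤
              K * d * Real.sqrt T * (1 + Real.log T) ^ p := by
  refine ⟨isGood_rectScore, 7, 1, by norm_num, fun d T hd hT => ?_⟩
  have hT1 : (1 : ℝ) ≤ T := by exact_mod_cast hT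
  have hd1 : (1 : ℝ) ≤ d := by exact_mod_cast hd
  set s := Real.sqrt T with hs
  have hss : s * s = T := Real.mul_self_sqrt (by positivity)
  have hs1 : 1 ≤ s := Real.one_le_sqrt.2 hT1
  -- The threshold `√T` balances `d * T / α` mistakes against about `d * (α + d)` abstentions, up to
  -- a logarithm.
  refine ⟨s, by positivity, fun tie target ht D _ R _ ν _ adv => ?_⟩
  have hprob : IsProbabilityMeasure (injectionLaw ν D) := by
    unfold injectionLaw
    infer_instance
  obtain ⟨hi1, hi2⟩ := integrable_errMis_errAbs ν D ht s tie adv T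
  have hint : Integrable (combinedError (potentialLearner (rectangles d) 1 (rectScore d) s tie)
      target adv T) (injectionLaw ν D) := hi1.add hi2
  refine ⟨hint, ?_⟩
  set ℓ := Real.log T with hℓ
  have hlog : 0 ≤ ℓ := Real.log_natCast_nonneg T
  rw [pow_one]
  -- The `d * d` part of the abstention bound is absorbed when `d ≤ √T`; otherwise the trivial bound
  -- `T ≤ d * √T` suffices.
  rcases le_total (d : ℝ) s with hds | hds
  · have hsplit : ∫ ω, combinedError (potentialLearner (rectangles d) 1 (rectScore d) s tie)
        target adv T ω ∂(injectionLaw ν D) = _ := integral_add hi1 hi2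
    rw [hsplit]
    have hmis : ∫ ω, (errMis (transcript (potentialLearner (rectangles d) 1 (rectScore d) s tie)
        target adv ω.1 ω.2 T) : ℝ) ∂(injectionLaw ν D) ≤ d * s := by
      refine (integral_mono hi1 (integrable_const (d * s : ℝ)) fun ω => ?_).trans (by simp)
      have h := mistakes_le (α := s) (tie := tie) ht adv ω.1 ω.2 T
      rw [← hss, ← mul_assoc, mul_comm] at h
      exact le_of_mul_le_mul_right h (by positivity)
    have hL : s + d ≤ ((⌈s⌉₊ + d : ℕ) : ℝ) + 1 := by
      have := Nat.le_ceil s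
      push_cast
      linarith
    have habs := integral_errAbs_le ν D ht (tie := tie) hL adv T
    -- The left side is at most `s + 1 + d + 2`, and both `d` and `1` are at most `s`.
    have hceil : ((⌈s⌉₊ + d : ℕ) : ℝ) + 2 ≤ 5 * s := by
      have := Nat.ceil_lt_add_one (a := s) (by positivity)
      push_cast
      linarith
    calc _ ≤ d * s + d * (((⌈s⌉₊ + d : ℕ) : ℝ) + 2) * (1 + ℓ) := add_le_add hmis habs
      _ ≤ d * s * (1 + ℓ) + d * (5 * s) * (1 + ℓ) := by
          refine add_le_add (le_mul_of_one_le_right (by positivity) (by linarith)) ?_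
          gcongr
      _ ≤ 7 * d * s * (1 + ℓ) := by
          have : 0 ≤ d * s * (1 + ℓ) := by positivity
          linarith
  · have hle : ∫ ω, combinedError (potentialLearner (rectangles d) 1 (rectScore d) s tie)
        target adv T ω ∂(injectionLaw ν D) ≤ T := by
      refine (integral_mono hint (integrable_const (T : ℝ)) fun ω => ?_).trans (by simp)
      unfold combinedError
      exact_mod_cast errMis_add_errAbs_le _
    calc _ ≤ (T : ℝ) := hle
      _ = s * s := hss.symm
      _ ≤ d * s := by gcongr
      _ ≤ d * s * (7 * (1 + ℓ)) := le_mul_of_one_le_right (by positivity) (by linarith)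
      _ = 7 * d * s * (1 + ℓ) := by ring
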